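/- Let $D,L,T>0$. Put $H^2_*=\{v\in H^2(0,L): v(0)=v_x(0)=0\}$ with $(v,\chi)_{H^2_*}=D(v_{xx},\chi_{xx})$, where $(\cdot,\cdot)$ is the $L^2(0,L)$ inner product, and $$\mathcal D(\mathcal A)=\{v\in H^4(0,L): v(0)=v_x(0)=0,\ v_{xx}(L)=v_{xxx}(L)=0\}$$ with the $H^4$ norm. Let $p\in L^2(0,T;L^2(0,L))$, $w_0\in H^2_*$, $w_1\in L^2(0,L)$. Consider the inextensible cantilever with stiffness effects only ($\sigma=1$, $\iota=k_2=0$): $$w_{tt}+D\partial_x^4w-D\partial_x\big[w_{xx}^2w_x\big]+D\partial_{xx}\big[w_{xx}w_x^2\big]=p\quad\text{in }(0,L)\times(0,T),\qquad(1)$$ $$w(0,t)=w_x(0,t)=0,\quad w_{xx}(L,t)=w_{xxx}(L,t)=0,\quad w(t=0)=w_0,\ w_t(t=0)=w_1 .$$ A *weak solution* is a function $w\in L^2(0,T;H^2_*)$ with weak time derivatives $w_t\in L^2(0,T;L^2(0,L))$ and $w_{tt}\in L^2(0,T;[H^2_*]')$ such that, for every $\phi\in H^2_*$ and almost every $t\in(0,T)$,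 $$\langle w_{tt},\phi\rangle+D(w_{xx},\phi_{xx})+D(w_{xx}w_x,w_x\phi_{xx})+D(w_{xx}w_x,w_{xx}\phi_x)=(p,\phi),$$ and such that, as $t\to0^+$ outside a null set of times, $(w(t),\chi)_{H^2_*}\to(w_0,\chi)_{H^2_*}$ for all $\chi\in H^2_*$ and $(w_t(t),\psi)\to(w_1,\psi)$ for all $\psi\in L^2(0,L)$. A *strong solution* is a weak solution with $w\in L^2(0,T;\mathcal D(\mathcal A))$, $w_t\in L^2(0,T;H^2_*)$ and $w_{tt}\in L^2(0,T;L^2(0,L))$. **Corollary.** Let $w$ be a strong solution. 1. $w$ satisfies (1) for almost every $t\in(0,T)$ and almost every $x\in(0,L)$. Here the derivatives are weak derivatives, and in particular $\partial_x[w_{xx}^2w_x]$, $\partial_x[w_{xx}w_x^2]$ and $\partial_{xx}[w_{xx}w_x^2]$ exist in $L^2(0,L)$ for almost every $t$. 2. If moreover $p\in H^2(0,T;L^2(0,L))$, then, for the representative $w\in C([0,T];H^3(0,L))$, the traces of $w_{xx}(\cdot,t)$ and $w_{xxx}(\cdot,t)$ at $x=L$ exist for every $t\in[0,T]$ and $$w_{xx}(L,t)=w_{xxx}(L,t)=0\quad\text{for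 all }0\le t\le T;$$ also $w(0,t)=w_x(0,t)=0$ for all $0\le t\le T$, $w(\cdot,0)=w_0$, and the representative $w_t\in C([0,T];L^2(0,L))$ satisfies $w_t(\cdot,0)=w_1$. Furthermore, the free boundary conditions need not be imposed beforehand: if $w$ is a weak solution with $w\in L^2(0,T;H^4(0,L))$, $w_t\in L^2(0,T;H^2_*)$ and $w_{tt}\in L^2(0,T;L^2(0,L))$, then $w(t)\in\mathcal D(\mathcal A)$ for almost every $t$, so that $w$ is a strong solution and 1 and 2 apply to it. -/

import Mathlib

open MeasureTheory Set Filter Topology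
open scoped ContDiff

namespace Cantilever

noncomputable section

/-- Lebesgue measure on the open interval `(0, a)`. -/
abbrev leb (a : ℝ) : Measure ℝ := (volume : Measure ℝ).restrict (Ioo 0 a)

/-- The Lebesgue space `L²(0, L)`. -/
abbrev L2 (L : ℝ) : Type := Lp ℝ 2 (leb L)

/-- Test functions on `(0, a)`: smooth with compact support contained in `(0, a)`. -/
def IsTest (a : ℝ) (φ : ℝ → ℝ) : Prop :=
  ContDiff ℝ ∞ φ ∧ HasCompactSupport φ ∧ tsupport φ ⊆ Ioo 0 a

/-- `g` is the weak derivative of `f` on `(0, L)`. -/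
structure HasWeakDeriv (L : ℝ) (f g : ℝ → ℝ) : Prop where
  locInt_left : LocallyIntegrableOn f (Ioo 0 L)
  locInt_right : LocallyIntegrableOn g (Ioo 0 L)
  integral_eq : ∀ φ : ℝ → ℝ, IsTest L φ →
    ∫ x in Ioo 0 L, f x * deriv φ x = - ∫ x in Ioo 0 L, g x * φ x

theorem L2.integrable {L : ℝ} (f : L2 L) : Integrable f (leb L) :=
  (Lp.memLp f).integrable (by norm_num)

theorem integrable_mul_bdd {L : ℝ} {f φ : ℝ → ℝ} (hf : Integrable f (leb L))
    (hφ : Continuous φ) (hc : HasCompactSupport φ) :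
    Integrable (fun x => f x * φ x) (leb L) := by
  obtain ⟨C, hC⟩ := hφ.bounded_above_of_compact_support hc
  exact hf.mul_bdd hφ.aestronglyMeasurable (Eventually.of_forall hC)

theorem HasWeakDeriv.add {L : ℝ} {f₁ g₁ f₂ g₂ : L2 L} (h₁ : HasWeakDeriv L f₁ g₁)
    (h₂ : HasWeakDeriv L f₂ g₂) : HasWeakDeriv L (f₁ + f₂ : L2 L) (g₁ + g₂ : L2 L) := by
  have li : ∀ f : L2 L, LocallyIntegrableOn f (Ioo 0 L) := fun f =>
    IntegrableOn.locallyIntegrableOn (L2.integrable f)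
  refine ⟨li _, li _, fun φ hφ => ?_⟩
  have key : ∀ (f g : L2 L) (ψ : ℝ → ℝ), Continuous ψ → HasCompactSupport ψ →
      ∫ x in Ioo 0 L, (f + g : L2 L) x * ψ x
        = (∫ x in Ioo 0 L, f x * ψ x) + ∫ x in Ioo 0 L, g x * ψ x := by
    intro f g ψ h1 h2
    rw [← integral_add (integrable_mul_bdd (L2.integrable f) h1 h2)
      (integrable_mul_bdd (L2.integrable g) h1 h2)]
    refine integral_congr_ae ?_
    filter_upwards [Lp.coeFn_add f g] with x hx
    rw [hx, Pi.add_apply, add_mul]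
  rw [key _ _ _ (hφ.1.continuous_deriv (by simp)) hφ.2.1.deriv,
    key _ _ _ hφ.1.continuous hφ.2.1, h₁.integral_eq φ hφ, h₂.integral_eq φ hφ]
  ring

theorem HasWeakDeriv.smul {L : ℝ} (c : ℝ) {f g : L2 L} (h : HasWeakDeriv L f g) :
    HasWeakDeriv L (c • f : L2 L) (c • g : L2 L) := by
  have li : ∀ f : L2 L, LocallyIntegrableOn f (Ioo 0 L) := fun f =>
    IntegrableOn.locallyIntegrableOn (L2.integrable f)
  refine ⟨li _, li _, fun φ hφ => ?_⟩
  have key : ∀ (f : L2 L) (ψ : ℝ → ℝ),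
      ∫ x in Ioo 0 L, (c • f : L2 L) x * ψ x = c * ∫ x in Ioo 0 L, f x * ψ x := by
    intro f ψ
    rw [← integral_const_mul]
    refine integral_congr_ae ?_
    filter_upwards [Lp.coeFn_smul c f] with x hx
    rw [hx, Pi.smul_apply, smul_eq_mul, mul_assoc]
  rw [key, key, h.integral_eq φ hφ]
  ring

theorem HasWeakDeriv.zero {L : ℝ} : HasWeakDeriv L (0 : L2 L) (0 : L2 L) := by
  have li : ∀ f : L2 L, LocallyIntegrableOn f (Ioo 0 L) := fun f =>
    IntegrableOn.locallyIntegrableOn (L2.integrable f)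
  refine ⟨li _, li _, fun φ _ => ?_⟩
  have key : ∀ ψ : ℝ → ℝ, ∫ x in Ioo 0 L, (0 : L2 L) x * ψ x = 0 := by
    intro ψ
    refine integral_eq_zero_of_ae ?_
    filter_upwards [Lp.coeFn_zero ℝ 2 (leb L)] with x hx
    rw [hx]; simp
  rw [key, key, neg_zero]

/-- The Sobolev space `H^m(0, L)`, as the space of tuples `(v, v', …, v^(m))` in `L²(0, L)` in which
each entry is the weak derivative of the previous one. The norm is
`‖v‖² = ∑_{k ≤ m} ‖v^(k)‖²`. -/
def sobolev (L : ℝ) (m : ℕ) : Submodule ℝ (PiLp 2 (fun _ : Fin (m + 1) => L2 L)) where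
  carrier := {v | ∀ k : Fin m, HasWeakDeriv L (v k.castSucc) (v k.succ)}
  add_mem' := fun h₁ h₂ k => (h₁ k).add (h₂ k)
  zero_mem' := fun _ => HasWeakDeriv.zero
  smul_mem' := fun c _ h k => (h k).smul c

/-- The type of elements of `H^m(0, L)`. -/
abbrev Sob (L : ℝ) (m : ℕ) : Type := sobolev L m

/-- The `k`-th weak derivative `∂_x^k v` of `v ∈ H^m(0, L)`, for `k ≤ m`. -/
def Sob.d {L : ℝ} {m : ℕ} (v : Sob L m) (k : Fin (m + 1)) : L2 L := v.1 k

/-- The inclusion `H^m(0, L) ⊆ H^j(0, L)` for `j ≤ m`. -/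
def Sob.incl {L : ℝ} {m : ℕ} (j : ℕ) (h : j ≤ m) (v : Sob L m) : Sob L j :=
  ⟨WithLp.toLp 2 (fun k => v.1 (k.castLE (by lia))), fun k => v.2 (k.castLE h)⟩

/-- The continuous representative of `f` on `[0, L]` exists and takes the value `c` at `a`. -/
def HasValueAt (L : ℝ) (f : ℝ → ℝ) (a c : ℝ) : Prop :=
  ∃ g : ℝ → ℝ, ContinuousOn g (Icc 0 L) ∧ f =ᵐ[leb L] g ∧ g a = c

/-- `H²_* = {v ∈ H²(0, L) : v(0) = 0, v_x(0) = 0}`. -/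
def H2star (L : ℝ) : Submodule ℝ (Sob L 2) where
  carrier := {v | HasValueAt L (v.d 0) 0 0 ∧ HasValueAt L (v.d 1) 0 0}
  add_mem' := by
    have key : ∀ f₁ f₂ : L2 L, HasValueAt L f₁ 0 0 → HasValueAt L f₂ 0 0 →
        HasValueAt L (f₁ + f₂ : L2 L) 0 0 := by
      rintro f₁ f₂ ⟨g₁, c₁, e₁, z₁⟩ ⟨g₂, c₂, e₂, z₂⟩
      refine ⟨g₁ + g₂, c₁.add c₂, ?_, by simp [z₁, z₂]⟩
      exact (Lp.coeFn_add f₁ f₂).trans (e₁.add e₂)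
    exact fun {_ _} h₁ h₂ => ⟨key _ _ h₁.1 h₂.1, key _ _ h₁.2 h₂.2⟩
  zero_mem' := by
    have key : HasValueAt L (0 : L2 L) 0 0 :=
      ⟨0, continuousOn_const, Lp.coeFn_zero ℝ 2 (leb L), rfl⟩
    exact ⟨key, key⟩
  smul_mem' := by
    have key : ∀ (c : ℝ) (f : L2 L), HasValueAt L f 0 0 → HasValueAt L (c • f : L2 L) 0 0 := by
      rintro c f ⟨g, cg, e, z⟩
      exact ⟨c • g, cg.const_smul c, (Lp.coeFn_smul c f).trans (e.const_smul c), by simp [z]⟩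
    exact fun c _ h => ⟨key c _ h.1, key c _ h.2⟩

/-- `D(𝒜) = {v ∈ H⁴(0, L) : v(0) = v_x(0) = 0, v_xx(L) = v_xxx(L) = 0}`. -/
def domA (L : ℝ) : Set (Sob L 4) :=
  {v | HasValueAt L (v.d 0) 0 0 ∧ HasValueAt L (v.d 1) 0 0 ∧
    HasValueAt L (v.d 2) L 0 ∧ HasValueAt L (v.d 3) L 0}

/-- The inner product `(v, χ)_{H²_*} = D (v_xx, χ_xx)`. -/
def innerStar (D : ℝ) {L : ℝ} (v χ : Sob L 2) : ℝ :=
  D * ∫ x in Ioo 0 L, v.d 2 x * χ.d 2 x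

/-- The embedding `L²(0, L) → [H²_*]'`, sending `f` to `φ ↦ (f, φ)`. -/
def toDual {L : ℝ} (f : L2 L) : StrongDual ℝ (H2star L) :=
  (innerSL ℝ f).comp
    ((PiLp.proj 2 (fun _ : Fin (2 + 1) => L2 L) 0).comp
      ((sobolev L 2).subtypeL.comp (H2star L).subtypeL))

/-- `g` is the weak (distributional) derivative on `(0, T)` of the vector-valued function `f`
(used for integrable `f` and `g`). -/
def HasWeakTimeDeriv {X : Type*} [NormedAddCommGroup X] [NormedSpace ℝ X] [CompleteSpace X]
    (T : ℝ) (f g : ℝ → X) : Prop :=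
  ∀ η : ℝ → ℝ, IsTest T η →
    ∫ t in Ioo 0 T, deriv η t • f t = - ∫ t in Ioo 0 T, η t • g t

/-- `p ∈ H²(0, T; L²(0, L))`. -/
def MemH2Time {L : ℝ} (T : ℝ) (p : ℝ → L2 L) : Prop :=
  ∃ pt ptt : ℝ → L2 L,
    MemLp p 2 (leb T) ∧ MemLp pt 2 (leb T) ∧ MemLp ptt 2 (leb T) ∧
    HasWeakTimeDeriv T p pt ∧ HasWeakTimeDeriv T pt ptt

/-- Weak solutions of the stiffness-only problem on `(0, L) × (0, T)` with load `p` and initial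
data `w0`, `w1`; `wt` and `wtt` are the time derivatives of `w`. Initial values are limits as
`t → 0+` outside a null set of times, so that nothing depends on the representative. -/
structure IsWeakSolution (D L T : ℝ) (p : ℝ → L2 L) (w0 : H2star L) (w1 : L2 L)
    (w : ℝ → Sob L 2) (wt : ℝ → L2 L) (wtt : ℝ → StrongDual ℝ (H2star L)) : Prop where
  memLp_w : MemLp w 2 (leb T)
  mem_H2star : ∀ᵐ t ∂(leb T), w t ∈ H2star L
  memLp_wt : MemLp wt 2 (leb T)
  memLp_wtt : MemLp wtt 2 (leb T)
  deriv_w : HasWeakTimeDeriv T (fun t => (w t).d 0) wt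
  deriv_wt : HasWeakTimeDeriv T (fun t => toDual (wt t)) wtt
  weak_form : ∀ φ : H2star L, ∀ᵐ t ∂(leb T),
    wtt t φ
      + D * (∫ x in Ioo 0 L, (w t).d 2 x * φ.1.d 2 x)
      + D * (∫ x in Ioo 0 L, ((w t).d 2 x * (w t).d 1 x) * ((w t).d 1 x * φ.1.d 2 x))
      + D * (∫ x in Ioo 0 L, ((w t).d 2 x * (w t).d 1 x) * ((w t).d 2 x * φ.1.d 1 x))
    = ∫ x in Ioo 0 L, p t x * φ.1.d 0 x
  initial_w : ∀ χ : H2star L,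
    Tendsto (fun t => innerStar D (w t) χ.1) (𝓝[>] 0 ⊓ ae volume) (𝓝 (innerStar D w0.1 χ.1))
  initial_wt : ∀ ψ : L2 L,
    Tendsto (fun t => ∫ x in Ioo 0 L, wt t x * ψ x) (𝓝[>] 0 ⊓ ae volume)
      (𝓝 (∫ x in Ioo 0 L, w1 x * ψ x))

/-- Weak solutions with the additional regularity `w ∈ L²(0, T; H⁴(0, L))`,
`w_t ∈ L²(0, T; H²_*)`, `w_tt ∈ L²(0, T; L²(0, L))`. No condition at `x = L` is imposed. -/
structure IsH4WeakSolution (D L T : ℝ) (p : ℝ → L2 L) (w0 : H2star L) (w1 : L2 L)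
    (w : ℝ → Sob L 4) (wt : ℝ → H2star L) (wtt : ℝ → L2 L) : Prop where
  memLp_w : MemLp w 2 (leb T)
  memLp_wt : MemLp wt 2 (leb T)
  memLp_wtt : MemLp wtt 2 (leb T)
  weak : IsWeakSolution D L T p w0 w1
    (fun t => (w t).incl 2 (by lia)) (fun t => (wt t).1.d 0) (fun t => toDual (wtt t))

/-- Strong solutions: weak solutions with `w ∈ L²(0, T; D(𝒜))`, `w_t ∈ L²(0, T; H²_*)` and
`w_tt ∈ L²(0, T; L²(0, L))`. (`D(𝒜)` carries the `H⁴` norm, in which it is closed.) -/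
structure IsStrongSolution (D L T : ℝ) (p : ℝ → L2 L) (w0 : H2star L) (w1 : L2 L)
    (w : ℝ → Sob L 4) (wt : ℝ → H2star L) (wtt : ℝ → L2 L) : Prop
    extends IsH4WeakSolution D L T p w0 w1 w wt wtt where
  mem_domA : ∀ᵐ t ∂(leb T), w t ∈ domA L

/-- `w_tt + D ∂_x⁴ w - D ∂_x[w_xx² w_x] + D ∂_xx[w_xx w_x²] = p` at almost every `x ∈ (0, L)`, for
almost every `t ∈ (0, T)`. Here `n₁ = ∂_x[w_xx² w_x]`, `m = ∂_x[w_xx w_x²]` and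
`n₂ = ∂_xx[w_xx w_x²]` are functions in `L²(0, L)`, whose existence is part of the claim. -/
def SatisfiesPDE (D L T : ℝ) (p : ℝ → L2 L) (w : ℝ → Sob L 4) (wtt : ℝ → L2 L) : Prop :=
  ∀ᵐ t ∂(leb T), ∃ n₁ m n₂ : L2 L,
    HasWeakDeriv L (fun x => (w t).d 2 x ^ 2 * (w t).d 1 x) n₁ ∧
    HasWeakDeriv L (fun x => (w t).d 2 x * (w t).d 1 x ^ 2) m ∧
    HasWeakDeriv L m n₂ ∧
    ∀ᵐ x ∂(leb L), wtt t x + D * (w t).d 4 x - D * n₁ x + D * n₂ x = p t x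

/-- The representative `u ∈ C([0, T]; H³(0, L))` of `w` (unique by continuity) exists, satisfies all
four boundary conditions at every time `t ∈ [0, T]`, and together with the representative
`ut ∈ C([0, T]; L²(0, L))` of `w_t` it attains the initial data. -/
def SatisfiesBoundaryAndInitialConditions (L T : ℝ) (w0 : H2star L) (w1 : L2 L)
    (w : ℝ → Sob L 4) (wt : ℝ → H2star L) : Prop :=
  ∃ (u : ℝ → Sob L 3) (ut : ℝ → L2 L),
    ContinuousOn u (Icc 0 T) ∧ ContinuousOn ut (Icc 0 T) ∧
    (∀ᵐ t ∂(leb T), u t = (w t).incl 3 (by lia)) ∧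
    (∀ᵐ t ∂(leb T), ut t = (wt t).1.d 0) ∧
    (u 0).incl 2 (by lia) = w0.1 ∧ ut 0 = w1 ∧
    ∀ t ∈ Icc 0 T,
      HasValueAt L ((u t).d 0) 0 0 ∧ HasValueAt L ((u t).d 1) 0 0 ∧
      HasValueAt L ((u t).d 2) L 0 ∧ HasValueAt L ((u t).d 3) L 0

end

end Cantilever

/-! Everything is rewritten in terms of `f = w_xx` in `L²(0, L)`. The clamped conditions make `w_x`
and `w` the first and second primitives of `f` from the left end, `prim L f` and `prim L (prim L
f)`, and test functions in `H²_*` correspond to arbitrary `ψ = φ_xx` in `L²`. With `P(f, g) = (∫₀ˣ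
f) g` and `q = w_tt - p`, the weak form becomes `⟪q, prim (prim ψ)⟫ + D ⟪f, ψ⟫ + D ⟪P(f, f), P(f, ψ)
+ P(ψ, f)⟫ = 0` for all `ψ`, outside one null set of times (`weak_equation`).

The adjoint of `prim` is `primR`, integration up to the right end. Moving all primitives off `ψ`
therefore leaves a pointwise identity: `(1 + w_x²) w_xx` equals a combination of integrals from `x`
to `L` (`integrated_equation`). At `x = L` it forces `w_xx(L) = 0`; its derivative forces `w_xxx(L)
= 0`; its second derivative is the equation (1). This gives the natural boundary conditions and part
1 together. Since `1 + w_x² ≥ 1`, it also bounds `w_xxxx` by `w_tt - p` and `w_xx`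
(`stationary_regularity`).

For part 2 it is enough to bound `w_tt` in `L²` uniformly in time. Two time translates of `w` are
compared through the second-order Taylor remainder of the quartic elastic energy. This remainder is
coercive up to a multiple of `‖w(t+h) - w(t)‖²`, by interpolation for the accretive operator `prim`
(`norm_mulPrim_self_le`), and its growth rate is governed by `‖w_xxt‖`, which is integrable in time.
A two-sided Grönwall inequality started at one time of differentiability gives `w_t` Lipschitz in
time (`exists_difference_bound`, `exists_ae_bound_second_derivative`).

Hence `w_xxxx` is essentially bounded in time. By duality every value of the continuous
representative of `w_xx` is `primR (primR k)` with `‖k‖` bounded (`exists_eq_primR_primR`), so the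
free conditions hold at every time, and interpolation gives continuity of `w_xxx`
(`continuousOn_ofFourthDeriv`). -/

namespace Cantilever

/-! ### Integrability and almost-everywhere equality on a bounded interval. -/

section

variable {E : Type*} [NormedAddCommGroup E]

theorem intervalIntegrable_of_leb {a : ℝ} {v : ℝ → E} (hv : Integrable v (leb a)) {x y : ℝ}
    (hx : x ∈ Icc 0 a) (hy : y ∈ Icc 0 a) : IntervalIntegrable v volume x y := by
  have h1 : IntegrableOn v (Icc 0 a) volume := by
    rw [integrableOn_Icc_iff_integrableOn_Ioo]; exact hv
  exact (h1.mono_set (uIcc_subset_Icc hx hy)).intervalIntegrable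

/-- Closed intervals matter here: identities known almost everywhere become usable at the endpoints,
which is how traces are read off. -/
theorem eqOn_Icc_of_ae_eq {a : ℝ} (ha : 0 < a) {u v : ℝ → E} (hu : ContinuousOn u (Icc 0 a))
    (hv : ContinuousOn v (Icc 0 a)) (h : u =ᵐ[leb a] v) : EqOn u v (Icc 0 a) :=
  Measure.eqOn_Icc_of_ae_eq volume ha.ne
    (h.filter_mono (by rw [leb, Measure.restrict_congr_set Ioo_ae_eq_Icc])) hu hv

theorem aestronglyMeasurable_leb {a : ℝ} {u : ℝ → E} (hu : ContinuousOn u (Icc 0 a)) :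
    AEStronglyMeasurable u (leb a) :=
  (hu.mono Ioo_subset_Icc_self).aestronglyMeasurable measurableSet_Ioo

end

/-! ### Calculus of primitives: absolute continuity and the product rule. -/

section Primitive

variable {E F G : Type*} [NormedAddCommGroup E] [NormedSpace ℝ E]
  [NormedAddCommGroup F] [NormedSpace ℝ F] [NormedAddCommGroup G] [NormedSpace ℝ G]

/-- The sum of increments over disjoint intervals is dominated termwise. Two comparison functions
are allowed because increments of a product involve both factors. -/
theorem _root_.AbsolutelyContinuousOnInterval.of_dist_le {X Y Z : Type*} [PseudoMetricSpace X]
    [PseudoMetricSpace Y] [PseudoMetricSpace Z] {f : ℝ → X} {g : ℝ → Y} {h : ℝ → Z} {a b C : ℝ}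
    (hg : AbsolutelyContinuousOnInterval g a b) (hh : AbsolutelyContinuousOnInterval h a b)
    (hle : ∀ x ∈ uIcc a b, ∀ y ∈ uIcc a b,
      dist (f x) (f y) ≤ C * (dist (g x) (g y) + dist (h x) (h y))) :
    AbsolutelyContinuousOnInterval f a b := by
  unfold AbsolutelyContinuousOnInterval at hg hh ⊢
  refine squeeze_zero' ?_ ?_ (by simpa using (hg.add hh).const_mul C)
  · exact Eventually.of_forall fun _ => Finset.sum_nonneg fun i hi => dist_nonneg
  rw [eventually_inf_principal]
  filter_upwards with (n, I) hnI
  simp only [← Finset.sum_add_distrib, Finset.mul_sum]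
  exact Finset.sum_le_sum fun i hi => hle _ (hnI.1 i hi).1 _ (hnI.1 i hi).2

/-- `F` is a primitive on `[0, a]` of the integrable function `f`. -/
structure IsPrimitive (a : ℝ) (u v : ℝ → E) : Prop where
  integrable : Integrable v (leb a)
  eq_add : ∀ x ∈ Icc 0 a, u x = u 0 + ∫ y in (0 : ℝ)..x, v y

theorem integral_leb {a : ℝ} (ha : 0 ≤ a) (v : ℝ → E) :
    ∫ x in Ioo 0 a, v x = ∫ x in (0 : ℝ)..a, v x := by
  rw [intervalIntegral.integral_of_le ha, integral_Ioc_eq_integral_Ioo]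

theorem ae_leb_iff {a : ℝ} {p : ℝ → Prop} : (∀ᵐ x ∂leb a, p x) ↔ ∀ᵐ x, x ∈ Ioo 0 a → p x :=
  ae_restrict_iff' measurableSet_Ioo

theorem intervalIntegral_congr_leb {a : ℝ} {v v' : ℝ → E} (h : v =ᵐ[leb a] v') {x y : ℝ}
    (hx : x ∈ Icc 0 a) (hy : y ∈ Icc 0 a) : ∫ t in x..y, v t = ∫ t in x..y, v' t := by
  refine intervalIntegral.integral_congr_ae ?_
  have h0 : ∀ᵐ z : ℝ, z ≠ a := by simp [ae_iff, measure_singleton]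
  filter_upwards [ae_leb_iff.1 h, h0] with z hz hza hzm
  refine hz ⟨?_, ?_⟩
  · exact lt_of_le_of_lt (le_min hx.1 hy.1) hzm.1
  · exact lt_of_le_of_ne (hzm.2.trans (max_le hx.2 hy.2)) hza

theorem isPrimitive_integral {a : ℝ} {v : ℝ → E} (hv : Integrable v (leb a)) (c : E) :
    IsPrimitive a (fun x => c + ∫ y in (0 : ℝ)..x, v y) v :=
  ⟨hv, fun x hx => by simp⟩

namespace IsPrimitive

variable {a : ℝ} {u v u' v' : ℝ → E}

theorem sub_eq (h : IsPrimitive a u v) {x y : ℝ} (hx : x ∈ Icc 0 a) (hy : y ∈ Icc 0 a) :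
    u y - u x = ∫ t in x..y, v t := by
  have h0 : (0 : ℝ) ∈ Icc 0 a := ⟨le_rfl, hx.1.trans hx.2⟩
  rw [h.eq_add y hy, h.eq_add x hx, add_sub_add_left_eq_sub,
    intervalIntegral.integral_interval_sub_left (intervalIntegrable_of_leb h.integrable h0 hy)
      (intervalIntegrable_of_leb h.integrable h0 hx)]

theorem congr (h : IsPrimitive a u v) (h1 : EqOn u u' (Icc 0 a)) (h2 : v =ᵐ[leb a] v') :
    IsPrimitive a u' v' := by
  refine ⟨h.integrable.congr h2, fun x hx => ?_⟩
  have h0 : (0 : ℝ) ∈ Icc 0 a := ⟨le_rfl, hx.1.trans hx.2⟩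
  rw [← h1 hx, ← h1 h0, h.eq_add x hx, intervalIntegral_congr_leb h2 h0 hx]

theorem dist_le (h : IsPrimitive a u v) {x y : ℝ} (hx : x ∈ Icc 0 a) (hy : y ∈ Icc 0 a) :
    dist (u x) (u y) ≤ dist (∫ t in (0 : ℝ)..x, ‖v t‖) (∫ t in (0 : ℝ)..y, ‖v t‖) := by
  have h0 : (0 : ℝ) ∈ Icc 0 a := ⟨le_rfl, hx.1.trans hx.2⟩
  rw [dist_eq_norm, dist_eq_norm, h.sub_eq hy hx,
    intervalIntegral.integral_interval_sub_left
      (intervalIntegrable_of_leb h.integrable h0 hx).norm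
      (intervalIntegrable_of_leb h.integrable h0 hy).norm]
  exact intervalIntegral.norm_integral_le_abs_integral_norm

theorem absolutelyContinuousOnInterval (h : IsPrimitive a u v) (ha : 0 ≤ a) :
    AbsolutelyContinuousOnInterval u 0 a := by
  have h0 : (0 : ℝ) ∈ Icc 0 a := ⟨le_rfl, ha⟩
  have h1 : AbsolutelyContinuousOnInterval (fun x => ∫ t in (0 : ℝ)..x, ‖v t‖) 0 a :=
    IntervalIntegrable.absolutelyContinuousOnInterval_intervalIntegral
      (intervalIntegrable_of_leb h.integrable h0 ⟨ha, le_rfl⟩).norm (by simp)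
  refine AbsolutelyContinuousOnInterval.of_dist_le (C := 1) h1 h1 fun x hx y hy => ?_
  rw [uIcc_of_le ha] at hx hy
  have := h.dist_le hx hy
  have h3 := dist_nonneg (x := ∫ t in (0 : ℝ)..x, ‖v t‖) (y := ∫ t in (0 : ℝ)..y, ‖v t‖)
  linarith

theorem continuousOn (h : IsPrimitive a u v) : ContinuousOn u (Icc 0 a) := by
  rcases le_or_gt 0 a with ha | ha
  · simpa [uIcc_of_le ha] using (h.absolutelyContinuousOnInterval ha).continuousOn
  · simp [Icc_eq_empty (not_le.2 ha)]

theorem ae_hasDerivAt [CompleteSpace E] (h : IsPrimitive a u v) :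
    ∀ᵐ x ∂leb a, HasDerivAt u (v x) x := by
  rcases lt_or_ge 0 a with ha | ha
  swap
  · simp [leb, Ioo_eq_empty (not_lt.2 ha)]
  have h0 : (0 : ℝ) ∈ Icc 0 a := ⟨le_rfl, ha.le⟩
  have h1 := (intervalIntegrable_of_leb h.integrable h0 ⟨ha.le, le_rfl⟩).ae_hasDerivAt_integral
  rw [ae_leb_iff]
  filter_upwards [h1] with x hx hxm
  have h2 := (hx (by rw [uIcc_of_le ha.le]; exact Ioo_subset_Icc_self hxm) 0 (by simp)).const_add
    (u 0)
  refine h2.congr_of_eventuallyEq ?_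
  filter_upwards [Ioo_mem_nhds hxm.1 hxm.2] with y hy using h.eq_add y (Ioo_subset_Icc_self hy)

/-- The difference between `u` and the integral of `v` is absolutely continuous with zero derivative
almost everywhere, hence constant. -/
theorem of_absolutelyContinuous [CompleteSpace E] (ha : 0 ≤ a)
    (hu : AbsolutelyContinuousOnInterval u 0 a) (hv : Integrable v (leb a))
    (hd : ∀ᵐ x ∂leb a, HasDerivAt u (v x) x) : IsPrimitive a u v := by
  refine ⟨hv, fun x hx => ?_⟩
  have h1 := isPrimitive_integral hv 0
  have h2 : AbsolutelyContinuousOnInterval (fun x => u x - (0 + ∫ y in (0 : ℝ)..x, v y)) 0 a :=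
    hu.sub (h1.absolutelyContinuousOnInterval ha)
  have h3 : ∀ᵐ x, x ∈ uIcc 0 a →
      HasDerivAt (fun x => u x - (0 + ∫ y in (0 : ℝ)..x, v y)) 0 x := by
    have e0 : ∀ᵐ z : ℝ, z ≠ a := by simp [ae_iff, measure_singleton]
    have e1 : ∀ᵐ z : ℝ, z ≠ 0 := by simp [ae_iff, measure_singleton]
    filter_upwards [ae_leb_iff.1 hd, ae_leb_iff.1 h1.ae_hasDerivAt, e0, e1] with x k1 k2 k3 k4 hx
    rw [uIcc_of_le ha] at hx
    have hx' : x ∈ Ioo 0 a := ⟨lt_of_le_of_ne hx.1 k4.symm, lt_of_le_of_ne hx.2 k3⟩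
    simpa using (k1 hx').fun_sub (k2 hx')
  obtain ⟨C, hC⟩ := h2.const_of_ae_hasDerivAt_zero h3
  rw [uIcc_of_le ha] at hC
  have c1 := hC x hx
  have c0 := hC 0 ⟨le_rfl, ha⟩
  simp only [zero_add, intervalIntegral.integral_same, sub_zero] at c1 c0
  rw [c0, ← c1]; abel

/-- Absolute continuity follows from the increments of the factors and their sup bounds; the
derivative is then the ordinary product rule at almost every point. Integrations by parts in space
and energy identities in time both come from this. -/
theorem bilin [CompleteSpace E] [CompleteSpace F] [CompleteSpace G] (B : E →L[ℝ] F →L[ℝ] G)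
    {r s : ℝ → F} (h : IsPrimitive a u v) (k : IsPrimitive a r s) (ha : 0 ≤ a) :
    IsPrimitive a (fun x => B (u x) (r x)) (fun x => B (v x) (r x) + B (u x) (s x)) := by
  have hu := h.absolutelyContinuousOnInterval ha
  have hr := k.absolutelyContinuousOnInterval ha
  obtain ⟨c1, hc1⟩ := hu.exists_bound
  obtain ⟨c2, hc2⟩ := hr.exists_bound
  have aux : AbsolutelyContinuousOnInterval (fun x => B (u x) (r x)) 0 a := by
    refine AbsolutelyContinuousOnInterval.of_dist_le (C := ‖B‖ * (max |c1| |c2|)) hu hr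
      fun x hx y hy => ?_
    have e : B (u x) (r x) - B (u y) (r y) = B (u x - u y) (r x) + B (u y) (r x - r y) := by
      simp
    rw [dist_eq_norm, dist_eq_norm, dist_eq_norm, e]
    have m1 : ‖r x‖ ≤ max |c1| |c2| := ((hc2 x hx).trans (le_abs_self _)).trans (le_max_right _ _)
    have m2 : ‖u y‖ ≤ max |c1| |c2| := ((hc1 y hy).trans (le_abs_self _)).trans (le_max_left _ _)
    calc _ ≤ ‖B‖ * ‖u x - u y‖ * ‖r x‖ + ‖B‖ * ‖u y‖ * ‖r x - r y‖ :=
          (norm_add_le _ _).trans (add_le_add (B.le_opNorm₂ _ _) (B.le_opNorm₂ _ _))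
      _ ≤ ‖B‖ * ‖u x - u y‖ * (max |c1| |c2|) + ‖B‖ * (max |c1| |c2|) * ‖r x - r y‖ := by gcongr
      _ = _ := by ring
  refine of_absolutelyContinuous ha aux (Integrable.add ?_ ?_) ?_
  · refine Integrable.mono' (h.integrable.norm.const_mul (‖B‖ * |c2|)) ?_ ?_
    · exact B.aestronglyMeasurable_comp₂ h.integrable.aestronglyMeasurable
        (aestronglyMeasurable_leb k.continuousOn)
    · refine (ae_restrict_iff' measurableSet_Ioo).2 (Eventually.of_forall fun x hx => ?_)
      have hx' : x ∈ uIcc 0 a := by rw [uIcc_of_le ha]; exact Ioo_subset_Icc_self hx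
      calc _ ≤ ‖B‖ * ‖v x‖ * ‖r x‖ := B.le_opNorm₂ _ _
        _ ≤ ‖B‖ * ‖v x‖ * |c2| := by gcongr; exact (hc2 x hx').trans (le_abs_self _)
        _ = _ := by ring
  · refine Integrable.mono' (k.integrable.norm.const_mul (‖B‖ * |c1|)) ?_ ?_
    · exact B.aestronglyMeasurable_comp₂ (aestronglyMeasurable_leb h.continuousOn)
        k.integrable.aestronglyMeasurable
    · refine (ae_restrict_iff' measurableSet_Ioo).2 (Eventually.of_forall fun x hx => ?_)
      have hx' : x ∈ uIcc 0 a := by rw [uIcc_of_le ha]; exact Ioo_subset_Icc_self hx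
      calc _ ≤ ‖B‖ * ‖u x‖ * ‖s x‖ := B.le_opNorm₂ _ _
        _ ≤ ‖B‖ * |c1| * ‖s x‖ := by gcongr; exact (hc1 x hx').trans (le_abs_self _)
  · filter_upwards [h.ae_hasDerivAt, k.ae_hasDerivAt] with x h1 h2
    have := (B.hasFDerivAt.comp_hasDerivAt x h1).clm_apply h2
    simpa using this

theorem clm [CompleteSpace E] [CompleteSpace F] (A : E →L[ℝ] F) (h : IsPrimitive a u v) :
    IsPrimitive a (fun x => A (u x)) (fun x => A (v x)) := by
  refine ⟨A.integrable_comp h.integrable, fun x hx => ?_⟩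
  have h0 : (0 : ℝ) ∈ Icc 0 a := ⟨le_rfl, hx.1.trans hx.2⟩
  rw [h.eq_add x hx, map_add,
    A.intervalIntegral_comp_comm (intervalIntegrable_of_leb h.integrable h0 hx)]

theorem add (h : IsPrimitive a u v) (h' : IsPrimitive a u' v') :
    IsPrimitive a (fun x => u x + u' x) (fun x => v x + v' x) := by
  refine ⟨h.integrable.add h'.integrable, fun x hx => ?_⟩
  have h0 : (0 : ℝ) ∈ Icc 0 a := ⟨le_rfl, hx.1.trans hx.2⟩
  rw [h.eq_add x hx, h'.eq_add x hx,
    intervalIntegral.integral_add (intervalIntegrable_of_leb h.integrable h0 hx)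
      (intervalIntegrable_of_leb h'.integrable h0 hx)]
  abel

theorem const (c : E) : IsPrimitive a (fun _ => c) (fun _ => 0) :=
  ⟨integrable_zero _ _ _, fun x hx => by simp⟩

theorem const_smul (c : ℝ) (h : IsPrimitive a u v) :
    IsPrimitive a (fun x => c • u x) (fun x => c • v x) := by
  refine ⟨h.integrable.smul c, fun x hx => ?_⟩
  rw [h.eq_add x hx, intervalIntegral.integral_smul, smul_add]

theorem sub (h : IsPrimitive a u v) (h' : IsPrimitive a u' v') :
    IsPrimitive a (fun x => u x - u' x) (fun x => v x - v' x) := by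
  simpa [sub_eq_add_neg] using h.add (h'.const_smul (-1))

theorem mul {u v u' v' : ℝ → ℝ} (h : IsPrimitive a u v) (h' : IsPrimitive a u' v') (ha : 0 ≤ a) :
    IsPrimitive a (fun x => u x * u' x) (fun x => v x * u' x + u x * v' x) := by
  simpa using bilin (ContinuousLinearMap.mul ℝ ℝ) h h' ha

theorem shift {h : ℝ} (hu : IsPrimitive a u v) (h0 : 0 ≤ h) (ha : h ≤ a) :
    IsPrimitive (a - h) (fun x => u (x + h)) (fun x => v (x + h)) := by
  refine ⟨?_, fun x hx => ?_⟩
  · have h1 : IntegrableOn v (Ioo h a) := IntegrableOn.mono_set hu.integrable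
      (Ioo_subset_Ioo_left h0)
    have h2 := (measurePreserving_add_right volume h).integrableOn_comp_preimage
      (measurableEmbedding_addRight h) (f := v) (s := Ioo h a)
    have h3 : (fun x => x + h) ⁻¹' Ioo h a = Ioo 0 (a - h) := by
      ext x; simp only [mem_preimage, mem_Ioo]; constructor <;> rintro ⟨_, _⟩ <;> constructor <;>
        linarith
    rw [h3] at h2
    exact h2.2 h1
  · have h1 := hu.sub_eq (x := h) (y := x + h) ⟨h0, ha⟩
      ⟨by linarith [hx.1], by linarith [hx.2]⟩
    rw [intervalIntegral.integral_comp_add_right (fun y => v y) h, zero_add, ← h1]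
    simp

theorem mono (h : IsPrimitive a u v) {b : ℝ} (hb : b ≤ a) : IsPrimitive b u v :=
  ⟨IntegrableOn.mono_set h.integrable (Ioo_subset_Ioo_right hb),
    fun x hx => h.eq_add x ⟨hx.1, hx.2.trans hb⟩⟩

theorem ae_unique [CompleteSpace E] (h : IsPrimitive a u v) (h' : IsPrimitive a u v') :
    v =ᵐ[leb a] v' := by
  filter_upwards [h.ae_hasDerivAt, h'.ae_hasDerivAt] with x h1 h2 using h1.unique h2

end IsPrimitive

end Primitive

/-! ### Test functions and the du Bois-Reymond lemma. -/

theorem IsTest.integrable_smul {a : ℝ} {φ : ℝ → ℝ} (h : IsTest a φ) {E : Type*}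
    [NormedAddCommGroup E] [NormedSpace ℝ E] {f : ℝ → E}
    (hf : Integrable f (leb a)) : Integrable (fun x => φ x • f x) (leb a) := by
  obtain ⟨C, hC⟩ := h.1.continuous.bounded_above_of_compact_support h.2.1
  exact hf.bdd_smul C h.1.continuous.aestronglyMeasurable (Eventually.of_forall hC)

section DuBoisReymond

variable {E : Type*} [NormedAddCommGroup E] [NormedSpace ℝ E] [CompleteSpace E]

theorem IsTest.isTest_deriv {a : ℝ} {φ : ℝ → ℝ} (h : IsTest a φ) : IsTest a (deriv φ) :=
  ⟨h.1.iterate_deriv 1, h.2.1.deriv, (tsupport_deriv_subset).trans h.2.2⟩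

theorem IsTest.eq_zero {a : ℝ} {φ : ℝ → ℝ} (h : IsTest a φ) {x : ℝ} (hx : x ∉ Ioo 0 a) :
    φ x = 0 :=
  image_eq_zero_of_notMem_tsupport fun h' => hx (h.2.2 h')

theorem isPrimitive_of_contDiff {a : ℝ} {φ : ℝ → ℝ} (h : ContDiff ℝ ∞ φ) :
    IsPrimitive a φ (deriv φ) := by
  have hc : Continuous (deriv φ) := h.continuous_deriv (by simp)
  refine ⟨?_, fun x _ => ?_⟩
  · exact (hc.integrableOn_Icc (a := 0) (b := a)).mono_set Ioo_subset_Icc_self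
  · rw [intervalIntegral.integral_deriv_eq_sub
      (fun y _ => (h.differentiable (by simp)) y) (hc.intervalIntegrable _ _)]
    ring

theorem IsPrimitive.integral_test {a : ℝ} (ha : 0 ≤ a) {u v : ℝ → E} (h : IsPrimitive a u v)
    {η : ℝ → ℝ} (hη : IsTest a η) :
    ∫ x in Ioo 0 a, deriv η x • u x = - ∫ x in Ioo 0 a, η x • v x := by
  have h1 := (isPrimitive_of_contDiff (a := a) hη.1).bilin (ContinuousLinearMap.lsmul ℝ ℝ) h ha
  have h2 := h1.eq_add a ⟨ha, le_rfl⟩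
  rw [← integral_leb ha] at h2
  simp only [ContinuousLinearMap.lsmul_apply, hη.eq_zero (x := a) (by simp),
    hη.eq_zero (x := 0) (by simp), zero_smul, zero_add] at h2
  have hu : Integrable u (leb a) :=
    (h.continuousOn.integrableOn_Icc).mono_set Ioo_subset_Icc_self
  rw [integral_add (hη.isTest_deriv.integrable_smul hu) (hη.integrable_smul h.integrable)] at h2
  exact eq_neg_of_add_eq_zero_left h2.symm

/-- The primitive from `0` vanishes to the left of the support of `ψ`, and to the right of it
because the total integral is zero, so it is again a test function. -/
theorem IsTest.integral_of_integral_eq_zero {a : ℝ} (ha : 0 < a) {ψ : ℝ → ℝ} (h : IsTest a ψ)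
    (h0 : ∫ x in Ioo 0 a, ψ x = 0) : ∃ η, IsTest a η ∧ deriv η = ψ := by
  have hd : ∀ x, HasDerivAt (fun x => ∫ y in (0 : ℝ)..x, ψ y) (ψ x) x := fun x =>
    intervalIntegral.integral_hasDerivAt_right (h.1.continuous.intervalIntegrable _ _)
      (h.1.continuous.stronglyMeasurableAtFilter _ _) h.1.continuous.continuousAt
  have hde : deriv (fun x => ∫ y in (0 : ℝ)..x, ψ y) = ψ := funext fun x => (hd x).deriv
  obtain ⟨α, β, hα, hβ, hK⟩ : ∃ α β, 0 < α ∧ β < a ∧ tsupport ψ ⊆ Icc α β := by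
    rcases (tsupport ψ).eq_empty_or_nonempty with he | hne
    · exact ⟨a / 2, a / 2, by linarith, by linarith, by simp [he]⟩
    · have hc : IsCompact (tsupport ψ) := h.2.1
      refine ⟨sInf (tsupport ψ), sSup (tsupport ψ), (h.2.2 (hc.sInf_mem hne)).1,
        (h.2.2 (hc.sSup_mem hne)).2, fun x hx => ⟨csInf_le hc.bddBelow hx,
          le_csSup hc.bddAbove hx⟩⟩
  have hz : ∀ x, x ∉ Icc α β → ψ x = 0 := fun x hx =>
    image_eq_zero_of_notMem_tsupport fun h' => hx (hK h')
  have hout : Function.support (fun x => ∫ y in (0 : ℝ)..x, ψ y) ⊆ Icc α β := by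
    intro x hx
    by_contra hn
    apply hx
    change ∫ y in (0 : ℝ)..x, ψ y = 0
    rcases lt_or_ge x α with h1 | h1
    · refine (intervalIntegral.integral_congr (g := fun _ => 0) fun y hy => hz y fun hy' => ?_).trans
        (by simp)
      have := hy.2
      exact absurd hy'.1 (not_le.2 (this.trans_lt (max_lt hα h1)))
    · have h2 : β < x := by
        by_contra h3
        exact hn ⟨h1, not_lt.1 h3⟩
      rw [integral_leb ha.le] at h0
      rw [← intervalIntegral.integral_add_adjacent_intervals (b := a)
        (h.1.continuous.intervalIntegrable _ _) (h.1.continuous.intervalIntegrable _ _), h0, zero_add]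
      refine (intervalIntegral.integral_congr (g := fun _ => 0) fun y hy => hz y fun hy' => ?_).trans
        (by simp)
      exact absurd hy'.2 (not_le.2 (lt_of_lt_of_le (lt_min hβ h2) hy.1))
  have hts : tsupport (fun x => ∫ y in (0 : ℝ)..x, ψ y) ⊆ Icc α β :=
    closure_minimal hout isClosed_Icc
  refine ⟨fun x => ∫ y in (0 : ℝ)..x, ψ y, ⟨?_, ?_, ?_⟩, hde⟩
  · rw [contDiff_infty_iff_deriv, hde]
    exact ⟨fun x => (hd x).differentiableAt, h.1⟩
  · exact HasCompactSupport.of_support_subset_isCompact isCompact_Icc hout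
  · exact hts.trans fun x hx => ⟨hα.trans_le hx.1, hx.2.trans_lt hβ⟩

theorem exists_isTest_integral_eq_one {a : ℝ} (ha : 0 < a) :
    ∃ θ, IsTest a θ ∧ ∫ x in Ioo 0 a, θ x = 1 := by
  let b : ContDiffBump (a / 2) := ⟨a / 8, a / 4, by positivity, by linarith⟩
  refine ⟨b.normed volume, ⟨b.contDiff_normed, b.hasCompactSupport_normed, ?_⟩, ?_⟩
  · rw [b.tsupport_normed_eq, Real.closedBall_eq_Icc]
    intro x hx
    simp only [b, mem_Icc, mem_Ioo] at hx ⊢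
    constructor <;> linarith [hx.1, hx.2]
  · rw [setIntegral_eq_integral_of_forall_compl_eq_zero, b.integral_normed]
    intro x hx
    by_contra hne
    have : x ∈ Function.support (b.normed volume) := hne
    rw [b.support_normed_eq, Real.ball_eq_Ioo] at this
    apply hx
    simp only [b, mem_Ioo] at this ⊢
    constructor <;> linarith [this.1, this.2]

theorem ae_eq_zero_of_integral_test {a : ℝ} {f : ℝ → E} (hf : Integrable f (leb a))
    (h : ∀ η : ℝ → ℝ, IsTest a η → ∫ x in Ioo 0 a, η x • f x = 0) : f =ᵐ[leb a] 0 := by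
  have h1 : LocallyIntegrableOn f (Ioo 0 a) volume := IntegrableOn.locallyIntegrableOn hf
  have h2 := isOpen_Ioo.ae_eq_zero_of_integral_contDiff_smul_eq_zero h1 fun g g1 g2 g3 => by
    rw [← h g ⟨g1, g2, g3⟩]
    refine (setIntegral_eq_integral_of_forall_compl_eq_zero fun x hx => ?_).symm
    rw [image_eq_zero_of_notMem_tsupport fun h' => hx (g3 h'), zero_smul]
  exact ae_leb_iff.2 h2

/-- The lemma of du Bois-Reymond: a function with an integrable weak derivative agrees almost
everywhere with a primitive of it. -/
theorem exists_ae_eq_primitive {a : ℝ} (ha : 0 < a) {f g : ℝ → E} (hf : Integrable f (leb a))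
    (hg : Integrable g (leb a))
    (h : ∀ η : ℝ → ℝ, IsTest a η →
      ∫ x in Ioo 0 a, deriv η x • f x = - ∫ x in Ioo 0 a, η x • g x) :
    ∃ c : E, f =ᵐ[leb a] fun x => c + ∫ y in (0 : ℝ)..x, g y := by
  have hp := isPrimitive_integral hg 0
  set u : ℝ → E := fun x => 0 + ∫ y in (0 : ℝ)..x, g y with hu
  have hui : Integrable u (leb a) :=
    (hp.continuousOn.integrableOn_Icc).mono_set Ioo_subset_Icc_self
  have hw : Integrable (fun x => f x - u x) (leb a) := hf.sub hui
  have key : ∀ η : ℝ → ℝ, IsTest a η → ∫ x in Ioo 0 a, deriv η x • (f x - u x) = 0 := by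
    intro η hη
    simp_rw [smul_sub]
    rw [integral_sub (hη.isTest_deriv.integrable_smul hf) (hη.isTest_deriv.integrable_smul hui), h η hη,
      hp.integral_test ha.le hη, sub_self]
  obtain ⟨θ, hθ, hθ1⟩ := exists_isTest_integral_eq_one ha
  set c := ∫ x in Ioo 0 a, θ x • (f x - u x) with hc
  refine ⟨c, ?_⟩
  have hconst : Integrable (fun _ : ℝ => c) (leb a) := integrable_const c
  have h0 : (fun x => f x - u x - c) =ᵐ[leb a] 0 := by
    refine ae_eq_zero_of_integral_test (hw.sub hconst) fun φ hφ => ?_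
    have hφi : Integrable φ (leb a) :=
      (hφ.1.continuous.integrableOn_Icc (a := 0) (b := a)).mono_set Ioo_subset_Icc_self
    have hθi : Integrable θ (leb a) :=
      (hθ.1.continuous.integrableOn_Icc (a := 0) (b := a)).mono_set Ioo_subset_Icc_self
    set m := ∫ x in Ioo 0 a, φ x with hm
    -- Subtracting `m * θ` removes the mean, so the result is the derivative of a test function and
    -- `key` applies to it. Since `c` is the `θ`-weighted mean of `f - u`, what remains is `m • c`.
    have hψ : IsTest a (fun x => φ x - m * θ x) := by
      refine ⟨hφ.1.sub (contDiff_const.mul hθ.1), hφ.2.1.sub hθ.2.1.mul_left, ?_⟩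
      refine (tsupport_sub _ _).trans (union_subset hφ.2.2 ?_)
      exact (tsupport_mul_subset_right).trans hθ.2.2
    obtain ⟨η, hη, hηd⟩ := hψ.integral_of_integral_eq_zero ha (by
      rw [integral_sub hφi (hθi.const_mul m), integral_const_mul, hθ1, ← hm]; ring)
    have k := key η hη
    rw [hηd] at k
    simp_rw [sub_smul, mul_smul] at k
    rw [integral_sub (hφ.integrable_smul hw) ((hθ.integrable_smul hw).fun_smul m),
      integral_smul, ← hc] at k
    simp_rw [smul_sub (φ _) _ c]
    rw [integral_sub (hφ.integrable_smul hw) (hφ.integrable_smul hconst), integral_smul_const,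
      ← hm, k]
  filter_upwards [h0] with x hx
  have : f x - u x - c = 0 := hx
  simp only [hu, zero_add] at this
  rw [← sub_eq_zero, ← this]; abel

theorem HasWeakTimeDeriv.exists_isPrimitive {a : ℝ} (ha : 0 < a) {f g : ℝ → E}
    (hf : Integrable f (leb a)) (hg : Integrable g (leb a)) (h : HasWeakTimeDeriv a f g) :
    ∃ u, IsPrimitive a u g ∧ f =ᵐ[leb a] u := by
  obtain ⟨c, hc⟩ := exists_ae_eq_primitive ha hf hg h
  exact ⟨_, isPrimitive_integral hg c, hc⟩

theorem HasWeakDeriv.exists_isPrimitive {a : ℝ} (ha : 0 < a) {f g : ℝ → ℝ}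
    (hf : Integrable f (leb a)) (hg : Integrable g (leb a)) (h : HasWeakDeriv a f g) :
    ∃ u, IsPrimitive a u g ∧ f =ᵐ[leb a] u := by
  refine HasWeakTimeDeriv.exists_isPrimitive ha hf hg fun η hη => ?_
  simpa [mul_comm] using h.integral_eq η hη

/-- The converse of du Bois-Reymond: the weak derivatives in the equation are obtained by exhibiting
primitives. -/
theorem IsPrimitive.hasWeakDeriv {a : ℝ} (ha : 0 ≤ a) {u v f g : ℝ → ℝ} (h : IsPrimitive a u v)
    (hf : f =ᵐ[leb a] u) (hg : g =ᵐ[leb a] v) : HasWeakDeriv a f g := by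
  have hu : Integrable u (leb a) :=
    (h.continuousOn.integrableOn_Icc).mono_set Ioo_subset_Icc_self
  refine ⟨IntegrableOn.locallyIntegrableOn (hu.congr hf.symm),
    IntegrableOn.locallyIntegrableOn (h.integrable.congr hg.symm), fun η hη => ?_⟩
  have := h.integral_test ha hη
  simp only [smul_eq_mul] at this
  have e1 : ∫ x in Ioo 0 a, f x * deriv η x = ∫ x in Ioo 0 a, u x * deriv η x :=
    integral_congr_ae (hf.mul (EventuallyEq.refl _ (deriv η)))
  have e2 : ∫ x in Ioo 0 a, g x * η x = ∫ x in Ioo 0 a, v x * η x :=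
    integral_congr_ae (hg.mul (EventuallyEq.refl _ η))
  rw [e1, e2]
  simpa [mul_comm] using this

end DuBoisReymond

open scoped InnerProductSpace

/-! ### Integration operators on `L²(0, L)`, adjointness and interpolation. -/

noncomputable section Operators

variable {L : ℝ}

theorem inner_eq_integral (f g : L2 L) : ⟪f, g⟫_ℝ = ∫ x in Ioo 0 L, f x * g x := by
  rw [L2.inner_def]
  exact integral_congr_ae (Eventually.of_forall fun x => by simp [mul_comm])

theorem integrable_mul_L2 (f g : L2 L) : Integrable (fun x => f x * g x) (leb L) :=
  (Lp.memLp f).integrable_mul (Lp.memLp g)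

theorem abs_integral_abs_mul_le (f g : L2 L) : ∫ x in Ioo 0 L, |f x * g x| ≤ ‖f‖ * ‖g‖ := by
  have h : ⟪|f|, |g|⟫_ℝ = ∫ x in Ioo 0 L, |f x * g x| := by
    rw [inner_eq_integral]
    refine integral_congr_ae ?_
    filter_upwards [Lp.coeFn_abs f, Lp.coeFn_abs g] with x h1 h2
    rw [h1, h2, abs_mul]
  rw [← h, ← norm_abs_eq_norm f, ← norm_abs_eq_norm g]
  exact real_inner_le_norm _ _

/-- The constant function `1` in `L²(0, L)`. -/
def one (L : ℝ) : L2 L := Lp.const 2 (leb L) (1 : ℝ)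

theorem coe_one : (one L : ℝ → ℝ) =ᵐ[leb L] fun _ => 1 := Lp.coeFn_const ..

theorem isPrimitive_L2 (f : L2 L) : IsPrimitive L (fun x => ∫ y in (0 : ℝ)..x, f y) f :=
  ⟨L2.integrable f, fun x _ => by simp⟩

theorem integral_abs_le (f : L2 L) : ∫ x in Ioo 0 L, |f x| ≤ ‖one L‖ * ‖f‖ := by
  refine le_trans (le_of_eq ?_) (abs_integral_abs_mul_le (one L) f)
  refine integral_congr_ae ?_
  filter_upwards [coe_one (L := L)] with x h1
  rw [h1, one_mul]

theorem abs_intervalIntegral_le {v : ℝ → ℝ} (hv : Integrable v (leb L)) {x y : ℝ}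
    (hx : x ∈ Icc 0 L) (hy : y ∈ Icc 0 L) : |∫ t in x..y, v t| ≤ ∫ t in Ioo 0 L, |v t| := by
  refine (intervalIntegral.norm_integral_le_integral_norm_uIoc (f := v)).trans ?_
  simp only [Real.norm_eq_abs]
  rw [← integral_Ioc_eq_integral_Ioo]
  have h1 : IntegrableOn (fun t => |v t|) (Ioc 0 L) := by
    rw [integrableOn_Ioc_iff_integrableOn_Ioo]; exact hv.norm
  refine setIntegral_mono_set h1 (Eventually.of_forall fun t => abs_nonneg _)
    (LE.le.eventuallyLE (Ioc_subset_Ioc (le_min hx.1 hy.1) (max_le hx.2 hy.2)))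

theorem abs_primitive_le (f : L2 L) {x : ℝ} (hx : x ∈ Icc 0 L) :
    |∫ y in (0 : ℝ)..x, f y| ≤ ‖one L‖ * ‖f‖ :=
  (abs_intervalIntegral_le (L2.integrable f) ⟨le_rfl, hx.1.trans hx.2⟩ hx).trans
    (integral_abs_le f)

theorem ae_mem_Icc : ∀ᵐ x ∂leb L, x ∈ Icc 0 L :=
  ae_leb_iff.2 (Eventually.of_forall fun _ hx => Ioo_subset_Icc_self hx)

theorem memLp_mul_of_bound {u : ℝ → ℝ} (hu : ContinuousOn u (Icc 0 L)) (g : L2 L) :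
    MemLp (fun x => u x * g x) 2 (leb L) := by
  obtain ⟨C, hC⟩ := isCompact_Icc.exists_bound_of_continuousOn hu
  refine (Lp.memLp g).of_le_mul (c := C)
    ((aestronglyMeasurable_leb hu).mul (Lp.aestronglyMeasurable g)) ?_
  filter_upwards [ae_mem_Icc] with x hx
  rw [norm_mul]
  exact mul_le_mul_of_nonneg_right (hC x hx) (norm_nonneg _)

theorem memLp_of_continuousOn {u : ℝ → ℝ} (hu : ContinuousOn u (Icc 0 L)) :
    MemLp u 2 (leb L) := by
  refine (memLp_mul_of_bound hu (one L)).ae_eq ?_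
  filter_upwards [coe_one (L := L)] with x hx
  rw [hx, mul_one]

/-- The bilinear map `(f, g) ↦ (∫₀ˣ f) g` on `L²(0, L)`. -/
def mulPrim (L : ℝ) : L2 L →L[ℝ] L2 L →L[ℝ] L2 L :=
  LinearMap.mkContinuous₂
    (LinearMap.mk₂ ℝ (fun f g => (memLp_mul_of_bound (isPrimitive_L2 f).continuousOn g).toLp _)
      (by
        intro f f' g
        refine Lp.ext ?_
        filter_upwards [Lp.coeFn_add ((memLp_mul_of_bound (isPrimitive_L2 f).continuousOn g).toLp _)
          ((memLp_mul_of_bound (isPrimitive_L2 f').continuousOn g).toLp _),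
          MemLp.coeFn_toLp (memLp_mul_of_bound (isPrimitive_L2 f).continuousOn g),
          MemLp.coeFn_toLp (memLp_mul_of_bound (isPrimitive_L2 f').continuousOn g),
          MemLp.coeFn_toLp (memLp_mul_of_bound (isPrimitive_L2 (f + f')).continuousOn g),
          ae_mem_Icc] with x h1 h2 h3 h4 hx
        have h0 : (0 : ℝ) ∈ Icc 0 L := ⟨le_rfl, hx.1.trans hx.2⟩
        rw [h1, Pi.add_apply, h2, h3, h4, intervalIntegral_congr_leb (Lp.coeFn_add f f') h0 hx]
        simp only [Pi.add_apply]
        rw [intervalIntegral.integral_add (intervalIntegrable_of_leb (L2.integrable f) h0 hx)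
          (intervalIntegrable_of_leb (L2.integrable f') h0 hx), add_mul])
      (by
        intro c f g
        refine Lp.ext ?_
        filter_upwards [Lp.coeFn_smul c
            ((memLp_mul_of_bound (isPrimitive_L2 f).continuousOn g).toLp _),
          MemLp.coeFn_toLp (memLp_mul_of_bound (isPrimitive_L2 f).continuousOn g),
          MemLp.coeFn_toLp (memLp_mul_of_bound (isPrimitive_L2 (c • f)).continuousOn g),
          ae_mem_Icc] with x h1 h2 h4 hx
        have h0 : (0 : ℝ) ∈ Icc 0 L := ⟨le_rfl, hx.1.trans hx.2⟩
        rw [h1, Pi.smul_apply, h2, h4, intervalIntegral_congr_leb (Lp.coeFn_smul c f) h0 hx]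
        simp only [Pi.smul_apply, smul_eq_mul]
        rw [intervalIntegral.integral_const_mul, mul_assoc])
      (by
        intro f g g'
        refine Lp.ext ?_
        filter_upwards [Lp.coeFn_add ((memLp_mul_of_bound (isPrimitive_L2 f).continuousOn g).toLp _)
          ((memLp_mul_of_bound (isPrimitive_L2 f).continuousOn g').toLp _),
          MemLp.coeFn_toLp (memLp_mul_of_bound (isPrimitive_L2 f).continuousOn g),
          MemLp.coeFn_toLp (memLp_mul_of_bound (isPrimitive_L2 f).continuousOn g'),
          MemLp.coeFn_toLp (memLp_mul_of_bound (isPrimitive_L2 f).continuousOn (g + g')),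
          Lp.coeFn_add g g'] with x h1 h2 h3 h4 h5
        rw [h1, Pi.add_apply, h2, h3, h4, h5, Pi.add_apply, mul_add])
      (by
        intro c f g
        refine Lp.ext ?_
        filter_upwards [Lp.coeFn_smul c
            ((memLp_mul_of_bound (isPrimitive_L2 f).continuousOn g).toLp _),
          MemLp.coeFn_toLp (memLp_mul_of_bound (isPrimitive_L2 f).continuousOn g),
          MemLp.coeFn_toLp (memLp_mul_of_bound (isPrimitive_L2 f).continuousOn (c • g)),
          Lp.coeFn_smul c g] with x h1 h2 h4 h5
        rw [h1, Pi.smul_apply, h2, h4, h5, Pi.smul_apply, smul_eq_mul, smul_eq_mul]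
        ring))
    ‖one L‖ (by
      intro f g
      refine Lp.norm_le_mul_norm_of_ae_le_mul ?_
      filter_upwards [MemLp.coeFn_toLp (memLp_mul_of_bound (isPrimitive_L2 f).continuousOn g),
        ae_mem_Icc] with x h1 hx
      rw [LinearMap.mk₂_apply, h1, norm_mul]
      exact mul_le_mul_of_nonneg_right (abs_primitive_le f hx) (norm_nonneg _))

theorem coe_mulPrim (f g : L2 L) :
    (mulPrim L f g : ℝ → ℝ) =ᵐ[leb L] fun x => (∫ y in (0 : ℝ)..x, f y) * g x :=
  MemLp.coeFn_toLp (memLp_mul_of_bound (isPrimitive_L2 f).continuousOn g)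

/-- Integration from the left end, `f ↦ ∫₀ˣ f`, as an operator on `L²(0, L)`. -/
def prim (L : ℝ) : L2 L →L[ℝ] L2 L := (mulPrim L).flip (one L)

/-- Integration up to the right end, `f ↦ ∫ₓᴸ f`, as an operator on `L²(0, L)`. -/
def primR (L : ℝ) : L2 L →L[ℝ] L2 L := (innerSL ℝ (one L)).smulRight (one L) - prim L

theorem coe_prim (f : L2 L) : (prim L f : ℝ → ℝ) =ᵐ[leb L] fun x => ∫ y in (0 : ℝ)..x, f y := by
  filter_upwards [coe_mulPrim f (one L), coe_one (L := L)] with x h1 h2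
  change (mulPrim L f (one L) : ℝ → ℝ) x = _
  rw [h1, h2, mul_one]

theorem inner_one (hL : 0 ≤ L) (f : L2 L) : ⟪one L, f⟫_ℝ = ∫ y in (0 : ℝ)..L, f y := by
  rw [inner_eq_integral, ← integral_leb hL]
  refine integral_congr_ae ?_
  filter_upwards [coe_one (L := L)] with x h
  rw [h, one_mul]

theorem coe_primR (f : L2 L) : (primR L f : ℝ → ℝ) =ᵐ[leb L] fun x => ∫ y in x..L, f y := by
  have e : primR L f = ⟪one L, f⟫_ℝ • one L - prim L f := rfl
  rw [e]
  filter_upwards [Lp.coeFn_sub (⟪one L, f⟫_ℝ • one L) (prim L f),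
    Lp.coeFn_smul (⟪one L, f⟫_ℝ) (one L), coe_prim f, coe_one (L := L), ae_mem_Icc]
    with x h1 h2 h3 h4 hx
  have h0 : (0 : ℝ) ∈ Icc 0 L := ⟨le_rfl, hx.1.trans hx.2⟩
  have hl : L ∈ Icc 0 L := ⟨hx.1.trans hx.2, le_rfl⟩
  rw [h1, Pi.sub_apply, h2, Pi.smul_apply, h3, h4, inner_one hl.1,
    ← intervalIntegral.integral_interval_sub_left
      (intervalIntegrable_of_leb (L2.integrable f) h0 hl)
      (intervalIntegrable_of_leb (L2.integrable f) h0 hx)]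
  simp

theorem isPrimitive_right {v : ℝ → ℝ} (hL : 0 ≤ L) (hv : Integrable v (leb L)) :
    IsPrimitive L (fun x => ∫ y in x..L, v y) (fun x => -v x) := by
  refine ⟨hv.neg, fun x hx => ?_⟩
  have h0 : (0 : ℝ) ∈ Icc 0 L := ⟨le_rfl, hL⟩
  have hl : L ∈ Icc 0 L := ⟨hL, le_rfl⟩
  rw [intervalIntegral.integral_neg,
    ← intervalIntegral.integral_add_adjacent_intervals (intervalIntegrable_of_leb hv h0 hx)
      (intervalIntegrable_of_leb hv hx hl)]
  ring

/-- Integration by parts without boundary terms: one primitive vanishes at `0`, the other at `L`. -/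
theorem integral_primitive_mul {v w : ℝ → ℝ} (hL : 0 ≤ L) (hv : Integrable v (leb L))
    (hw : Integrable w (leb L)) :
    ∫ x in Ioo 0 L, (∫ y in (0 : ℝ)..x, v y) * w x =
      ∫ x in Ioo 0 L, v x * ∫ y in x..L, w y := by
  have hV := isPrimitive_integral hv 0
  simp only [zero_add] at hV
  have hW := isPrimitive_right hL hw
  have h := (hV.mul hW hL)
  have h2 := h.eq_add L ⟨hL, le_rfl⟩
  rw [intervalIntegral.integral_same, intervalIntegral.integral_same, mul_zero, zero_mul,
    zero_add, ← integral_leb hL] at h2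
  have i1 : Integrable (fun x => v x * ∫ y in x..L, w y) (leb L) := by
    obtain ⟨C, hC⟩ := isCompact_Icc.exists_bound_of_continuousOn hW.continuousOn
    refine hv.mul_bdd (c := C) (aestronglyMeasurable_leb hW.continuousOn) ?_
    filter_upwards [ae_mem_Icc] with x hx using hC x hx
  have i2 : Integrable (fun x => (∫ y in (0 : ℝ)..x, v y) * w x) (leb L) := by
    obtain ⟨C, hC⟩ := isCompact_Icc.exists_bound_of_continuousOn hV.continuousOn
    refine hw.bdd_mul (c := C) (aestronglyMeasurable_leb hV.continuousOn) ?_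
    filter_upwards [ae_mem_Icc] with x hx using hC x hx
  simp only [mul_neg, ← sub_eq_add_neg] at h2
  rw [integral_sub i1 i2] at h2
  linarith

theorem inner_prim_left (hL : 0 ≤ L) (f g : L2 L) : ⟪prim L f, g⟫_ℝ = ⟪f, primR L g⟫_ℝ := by
  rw [inner_eq_integral, inner_eq_integral]
  have e1 : ∫ x in Ioo 0 L, prim L f x * g x
      = ∫ x in Ioo 0 L, (∫ y in (0 : ℝ)..x, f y) * g x := by
    refine integral_congr_ae ?_
    filter_upwards [coe_prim f] with x h
    rw [h]
  have e2 : ∫ x in Ioo 0 L, f x * primR L g x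
      = ∫ x in Ioo 0 L, f x * ∫ y in x..L, g y := by
    refine integral_congr_ae ?_
    filter_upwards [coe_primR g] with x h
    rw [h]
  rw [e1, e2, integral_primitive_mul hL (L2.integrable f) (L2.integrable g)]

/-- `prim` plus its adjoint `primR` is the rank-one operator `f ↦ ⟪1, f⟫ 1`. Both operators are
therefore accretive. -/
theorem two_inner_prim_self (hL : 0 ≤ L) (f : L2 L) :
    2 * ⟪prim L f, f⟫_ℝ = ⟪one L, f⟫_ℝ ^ 2 := by
  have h := inner_prim_left hL f f
  have e : primR L f = ⟪one L, f⟫_ℝ • one L - prim L f := rfl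
  rw [e, inner_sub_right, inner_smul_right, real_inner_comm (prim L f) f,
    real_inner_comm (one L) f] at h
  linarith

theorem inner_prim_self_nonneg (hL : 0 ≤ L) (f : L2 L) : 0 ≤ ⟪prim L f, f⟫_ℝ := by
  have := two_inner_prim_self hL f
  nlinarith [sq_nonneg ⟪one L, f⟫_ℝ]

theorem inner_primR_self_nonneg (hL : 0 ≤ L) (f : L2 L) : 0 ≤ ⟪primR L f, f⟫_ℝ := by
  rw [real_inner_comm, ← inner_prim_left hL]
  exact inner_prim_self_nonneg hL f

/-- Interpolation between `u` and `J (J u)` for an accretive operator `J`. -/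
theorem norm_sq_apply_le_of_accretive {H : Type*} [NormedAddCommGroup H] [InnerProductSpace ℝ H]
    (J : H →L[ℝ] H) (hJ : ∀ u, 0 ≤ ⟪J u, u⟫_ℝ) (u : H) {ε : ℝ} (hε : 0 < ε) :
    ‖J u‖ ^ 2 ≤ 3 * (ε * ‖u‖ ^ 2 + ε⁻¹ * ‖J (J u)‖ ^ 2) := by
  obtain ⟨l, hl, rfl⟩ : ∃ l : ℝ, 0 < l ∧ l ^ 2 = ε := ⟨√ε, Real.sqrt_pos.2 hε, Real.sq_sqrt hε.le⟩
  -- Accretivity at this vector produces the term `-l⁻¹ ‖J u‖²`, so `‖J u‖²` is bounded by the other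
  -- three terms of the expansion.
  have h := hJ (u - l⁻¹ • J u)
  simp only [map_sub, map_smul, inner_sub_left, inner_sub_right, inner_smul_left,
    inner_smul_right, real_inner_self_eq_norm_sq, conj_trivial] at h
  have a1 := real_inner_le_norm (J u) u
  have a2 := real_inner_le_norm (J (J u)) (J u)
  have a3 := abs_real_inner_le_norm (J (J u)) u
  have a4 := abs_le.1 a3
  set x := ‖J u‖
  set y := ‖J (J u)‖
  set z := ‖u‖
  have hx : 0 ≤ x := norm_nonneg _
  have hy : 0 ≤ y := norm_nonneg _
  have hz : 0 ≤ z := norm_nonneg _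
  have hi : 0 < l⁻¹ := inv_pos.2 hl
  have hll : l * l⁻¹ = 1 := mul_inv_cancel₀ hl.ne'
  rw [inv_pow l 2 |>.symm]
  set m := l⁻¹
  have k1 : m * x ^ 2 ≤ z * x + m * (y * z) + m * (m * (y * x)) := by
    have b1 : m * (m * ⟪J (J u), J u⟫_ℝ) ≤ m * (m * (y * x)) := by gcongr
    have b2 : m * (-⟪J (J u), u⟫_ℝ) ≤ m * (y * z) := by
      gcongr; linarith [a4.1]
    nlinarith
  have k2 : x ^ 2 ≤ l * z * x + y * z + m * y * x := by
    have := mul_le_mul_of_nonneg_left k1 hl.le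
    calc x ^ 2 = l * m * x ^ 2 := by rw [hll]; ring
      _ = l * (m * x ^ 2) := by ring
      _ ≤ l * (z * x + m * (y * z) + m * (m * (y * x))) := this
      _ = l * z * x + (l * m) * (y * z) + (l * m) * (m * y * x) := by ring
      _ = _ := by rw [hll]; ring
  have k3 : y * z = (m * y) * (l * z) := by
    calc y * z = (l * m) * (y * z) := by rw [hll]; ring
      _ = _ := by ring
  rw [k3] at k2
  -- Each of the two products containing `x` costs `x² / 4`, and `(m y)(l z)` costs half the sum of
  -- squares; `x² / 2` is left against `3 / 2` of that sum, whence the factor `3`.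
  nlinarith [sq_nonneg (x - 2 * (l * z)), sq_nonneg (x - 2 * (m * y)),
    sq_nonneg (m * y - l * z)]

theorem norm_sq_prim_le (hL : 0 ≤ L) (f : L2 L) {ε : ℝ} (hε : 0 < ε) :
    ‖prim L f‖ ^ 2 ≤ 3 * (ε * ‖f‖ ^ 2 + ε⁻¹ * ‖prim L (prim L f)‖ ^ 2) :=
  norm_sq_apply_le_of_accretive _ (inner_prim_self_nonneg hL) f hε

theorem norm_sq_primR_le (hL : 0 ≤ L) (f : L2 L) {ε : ℝ} (hε : 0 < ε) :
    ‖primR L f‖ ^ 2 ≤ 3 * (ε * ‖f‖ ^ 2 + ε⁻¹ * ‖primR L (primR L f)‖ ^ 2) :=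
  norm_sq_apply_le_of_accretive _ (inner_primR_self_nonneg hL) f hε

/-- An Agmon inequality: the square of the primitive vanishes at `0` and has derivative twice the
product of the primitive with `f`. -/
theorem sq_primitive_le (f : L2 L) {x : ℝ} (hx : x ∈ Icc 0 L) :
    (∫ y in (0 : ℝ)..x, f y) ^ 2 ≤ 2 * (‖prim L f‖ * ‖f‖) := by
  have hL : 0 ≤ L := hx.1.trans hx.2
  have h0 : (0 : ℝ) ∈ Icc 0 L := ⟨le_rfl, hL⟩
  have h := (isPrimitive_L2 f).mul (isPrimitive_L2 f) hL
  have h2 := h.eq_add x hx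
  simp only [intervalIntegral.integral_same, mul_zero, zero_add] at h2
  have e : (fun x => f x * (∫ y in (0 : ℝ)..x, f y) + (∫ y in (0 : ℝ)..x, f y) * f x)
      =ᵐ[leb L] fun x => 2 * (prim L f x * f x) := by
    filter_upwards [coe_prim f] with x hx
    rw [hx]; ring
  rw [pow_two, h2, intervalIntegral_congr_leb e h0 hx, intervalIntegral.integral_const_mul]
  refine mul_le_mul_of_nonneg_left ((le_abs_self _).trans ?_) zero_le_two
  exact (abs_intervalIntegral_le (integrable_mul_L2 _ _) h0 hx).trans (abs_integral_abs_mul_le _ _)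

/-- The Agmon bound gives `‖P(f, f)‖ ≤ √2 ‖prim f‖^(1/2) ‖f‖^(3/2)`, and `‖prim f‖` is interpolated
between `‖f‖` and `‖prim (prim f)‖`. The quadratic map thus costs only a small multiple of `‖f‖²`
modulo the weaker norm, which makes the elastic energy coercive. -/
theorem norm_mulPrim_self_le (hL : 0 ≤ L) {ε : ℝ} (hε : 0 < ε) :
    ∃ C, ∀ f : L2 L, ‖mulPrim L f f‖ ≤ ε * ‖f‖ ^ 2 + C * ‖prim L (prim L f)‖ ^ 2 := by
  obtain ⟨δ, hδ, rfl⟩ : ∃ δ, 0 < δ ∧ 2 * δ = ε := ⟨ε / 2, by positivity, by ring⟩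
  refine ⟨3 / (2 * δ ^ 3) * (δ ^ 4 / 2)⁻¹, fun f => ?_⟩
  have h1 : ‖mulPrim L f f‖ ≤ √(2 * (‖prim L f‖ * ‖f‖)) * ‖f‖ := by
    refine Lp.norm_le_mul_norm_of_ae_le_mul ?_
    filter_upwards [coe_mulPrim f f, ae_mem_Icc] with x h1 hx
    rw [h1, norm_mul]
    exact mul_le_mul_of_nonneg_right (Real.abs_le_sqrt (sq_primitive_le f hx)) (norm_nonneg _)
  -- Division by `δ³` below turns this parameter into the coefficient `3δ/2` of `‖f‖²`. The
  -- contributions of `h4`, `h5` and `h6` then total `7δ/4`, within the allowed `2δ`.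
  have h2 := norm_sq_prim_le hL f (ε := δ ^ 4 / 2) (by positivity)
  set a := ‖f‖
  set b := ‖prim L f‖
  set n := ‖prim L (prim L f)‖
  have ha : 0 ≤ a := norm_nonneg _
  have hb : 0 ≤ b := norm_nonneg _
  have h3 : √(2 * (b * a)) ^ 2 = 2 * (b * a) := Real.sq_sqrt (by positivity)
  set s := √(2 * (b * a))
  have h4 : s * a ≤ (δ * a ^ 2 + s ^ 2 / δ) / 2 := by
    have : s * a = (s / δ) * (δ * a) := by field_simp
    have e2 : s ^ 2 / δ = δ * (s / δ) ^ 2 := by field_simp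
    rw [this, e2]
    nlinarith [mul_nonneg hδ.le (sq_nonneg (a - s / δ))]
  have h5 : s ^ 2 / δ ≤ δ * a ^ 2 + b ^ 2 / δ ^ 3 := by
    rw [h3]
    have e1 : 2 * (b * a) / δ = δ * (2 * a * (b / δ ^ 2)) := by field_simp
    have e2 : b ^ 2 / δ ^ 3 = δ * (b / δ ^ 2) ^ 2 := by field_simp
    rw [e1, e2]
    nlinarith [mul_nonneg hδ.le (sq_nonneg (a - b / δ ^ 2))]
  have h6 : b ^ 2 / δ ^ 3 ≤ 3 / 2 * δ * a ^ 2 + 2 * (3 / (2 * δ ^ 3) * (δ ^ 4 / 2)⁻¹ * n ^ 2) := by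
    calc b ^ 2 / δ ^ 3 ≤ (3 * (δ ^ 4 / 2 * a ^ 2 + (δ ^ 4 / 2)⁻¹ * n ^ 2)) / δ ^ 3 := by gcongr
      _ = _ := by field_simp
  nlinarith [mul_nonneg hδ.le (sq_nonneg a)]

end Operators

/-! ### Grönwall inequality in both time directions. -/

section Gronwall

theorem IsPrimitive.monotoneOn {a : ℝ} {u v : ℝ → ℝ} (h : IsPrimitive a u v)
    (hv : ∀ᵐ x ∂leb a, 0 ≤ v x) : MonotoneOn u (Icc 0 a) := by
  intro x hx y hy hxy
  have h1 := h.sub_eq hx hy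
  have h2 : v =ᵐ[leb a] fun t => |v t| := by
    filter_upwards [hv] with t ht using (abs_of_nonneg ht).symm
  rw [intervalIntegral_congr_leb h2 hx hy] at h1
  have := intervalIntegral.integral_nonneg_of_forall (μ := volume) hxy fun t => abs_nonneg (v t)
  linarith

/-- The exponential is Lipschitz on the bounded range of `u`, so the composition stays absolutely
continuous. -/
theorem IsPrimitive.exp {a : ℝ} (ha : 0 ≤ a) {u v : ℝ → ℝ} (h : IsPrimitive a u v) :
    IsPrimitive a (fun x => Real.exp (u x)) (fun x => Real.exp (u x) * v x) := by
  have hu := h.absolutelyContinuousOnInterval ha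
  obtain ⟨M, hM⟩ := hu.exists_bound
  have hlip : ∀ x ≤ M, ∀ y ≤ M, ‖Real.exp x - Real.exp y‖ ≤ Real.exp M * ‖x - y‖ := by
    intro x hx y hy
    refine (convex_Iic M).norm_image_sub_le_of_norm_hasDerivWithin_le
      (fun z _ => (Real.hasDerivAt_exp z).hasDerivWithinAt) (fun z hz => ?_) hy hx
    rw [Real.norm_eq_abs, Real.abs_exp]
    exact Real.exp_le_exp.2 hz
  have hc : ContinuousOn (fun x => Real.exp (u x)) (Icc 0 a) :=
    Real.continuous_exp.comp_continuousOn h.continuousOn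
  refine IsPrimitive.of_absolutelyContinuous ha
    (AbsolutelyContinuousOnInterval.of_dist_le (C := Real.exp M) hu hu fun x hx y hy => ?_) ?_ ?_
  · rw [dist_eq_norm, dist_eq_norm]
    have h1 := hlip (u x) ((le_abs_self _).trans (hM x hx)) (u y) ((le_abs_self _).trans (hM y hy))
    have h2 : 0 ≤ Real.exp M * ‖u x - u y‖ := by positivity
    rw [mul_add]
    linarith
  · refine h.integrable.bdd_mul (c := Real.exp M) (aestronglyMeasurable_leb hc) ?_
    filter_upwards [ae_mem_Icc] with x hx
    rw [Real.norm_eq_abs, Real.abs_exp]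
    exact Real.exp_le_exp.2 ((le_abs_self _).trans (hM x (by rwa [uIcc_of_le ha])))
  · filter_upwards [h.ae_hasDerivAt] with x hx using hx.exp

/-- A two-sided Grönwall inequality for absolutely continuous functions. -/
theorem IsPrimitive.gronwall {a : ℝ} {u v k : ℝ → ℝ} (h : IsPrimitive a u v)
    (hk : Integrable k (leb a)) (hk0 : ∀ t, 0 ≤ k t) (hu : ∀ t ∈ Icc 0 a, 0 ≤ u t)
    (hle : ∀ᵐ t ∂leb a, |v t| ≤ k t * u t) {s t : ℝ} (hs : s ∈ Icc 0 a) (ht : t ∈ Icc 0 a) :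
    u t ≤ u s * Real.exp (∫ x in Ioo 0 a, k x) := by
  have ha : 0 ≤ a := hs.1.trans hs.2
  have hκ := isPrimitive_integral hk 0
  set κ : ℝ → ℝ := fun x => 0 + ∫ y in (0 : ℝ)..x, k y
  have hm : MonotoneOn κ (Icc 0 a) := hκ.monotoneOn (Eventually.of_forall hk0)
  have h0 : (0 : ℝ) ∈ Icc 0 a := ⟨le_rfl, ha⟩
  have hl : a ∈ Icc 0 a := ⟨ha, le_rfl⟩
  have hκ0 : κ 0 = 0 := by simp [κ]
  have hκa : κ a = ∫ x in Ioo 0 a, k x := by simp [κ, integral_leb ha]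
  rw [← hκa]
  -- The two integrating factors: `u exp κ` is nondecreasing, which serves `t ≤ s`, and `u exp (-κ)`
  -- is nonincreasing, which serves `s ≤ t`.
  have m1 := h.mul (hκ.exp ha) ha
  have m2 := h.mul ((hκ.const_smul (-1)).exp ha) ha
  rcases le_total s t with hst | hst
  · have h3 := (m2.const_smul (-1)).monotoneOn (by
      filter_upwards [hle] with x hx
      have := (abs_le.1 hx).2
      have he := Real.exp_pos (-1 * κ x)
      simp only [smul_eq_mul]
      nlinarith) hs ht hst
    simp only [smul_eq_mul] at h3
    have h4 : u t * Real.exp (-1 * κ t) ≤ u s * Real.exp (-1 * κ s) := by linarith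
    have e1 : u t = u t * Real.exp (-1 * κ t) * Real.exp (κ t) := by
      rw [mul_assoc, ← Real.exp_add]; simp
    have h5 : -1 * κ s + κ t ≤ κ a := by
      have := hm h0 hs hs.1; have := hm ht hl ht.2; linarith
    calc u t = _ := e1
      _ ≤ u s * Real.exp (-1 * κ s) * Real.exp (κ t) := by gcongr
      _ = u s * Real.exp (-1 * κ s + κ t) := by rw [mul_assoc, ← Real.exp_add]
      _ ≤ _ := by have := hu s hs; gcongr
  · have h3 := m1.monotoneOn (by
      filter_upwards [hle] with x hx
      have := (abs_le.1 hx).1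
      have he := Real.exp_pos (κ x)
      nlinarith) ht hs hst
    have e1 : u t = u t * Real.exp (κ t) * Real.exp (-κ t) := by
      rw [mul_assoc, ← Real.exp_add]; simp
    have h5 : κ s + -κ t ≤ κ a := by
      have := hm h0 ht ht.1; have := hm hs hl hs.2; linarith
    calc u t = _ := e1
      _ ≤ u s * Real.exp (κ s) * Real.exp (-κ t) := by gcongr
      _ = u s * Real.exp (κ s + -κ t) := by rw [mul_assoc, ← Real.exp_add]
      _ ≤ _ := by have := hu s hs; gcongr

end Gronwall

/-! ### Relative energy of two solutions of the abstract equation. -/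

section Energy

variable {H : Type*} [NormedAddCommGroup H] [InnerProductSpace ℝ H]

/-- The remainder of order two in the expansion of the quartic energy `‖S f f‖² / 8` at `β`. -/
theorem quartic_expansion (S : H →L[ℝ] H →L[ℝ] H) (hS : ∀ f g, S f g = S g f) (α β : H) :
    ‖S α α‖ ^ 2 - ‖S β β‖ ^ 2 - 4 * ⟪S β β, S β (α - β)⟫_ℝ =
      ‖(2 : ℝ) • S β (α - β) + S (α - β) (α - β)‖ ^ 2
        + 2 * ⟪S β β, S (α - β) (α - β)⟫_ℝ := by
  obtain ⟨ζ, rfl⟩ : ∃ ζ, α = β + ζ := ⟨α - β, by abel⟩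
  simp only [← real_inner_self_eq_norm_sq, add_sub_cancel_left, map_add, hS ζ β,
    inner_add_left, inner_add_right, inner_smul_left, inner_smul_right, conj_trivial,
    _root_.add_apply, real_inner_comm (S β ζ) (S β β),
    real_inner_comm (S ζ ζ) (S β β), real_inner_comm (S ζ ζ) (S β ζ)]
  ring

/-- The left side is the map `α ↦ ⟪S α α, S α γ⟫` minus its first-order Taylor polynomial at `β`, so
only terms at least quadratic in `α - β` survive. -/
theorem quartic_remainder (S : H →L[ℝ] H →L[ℝ] H) (hS : ∀ f g, S f g = S g f) (α β γ : H) :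
    ⟪S α α, S α γ⟫_ℝ - ⟪S β β, S β γ⟫_ℝ - 2 * ⟪S β γ, S β (α - β)⟫_ℝ
        - ⟪S β β, S γ (α - β)⟫_ℝ =
      2 * ⟪S β (α - β), S (α - β) γ⟫_ℝ + ⟪S (α - β) (α - β), S β γ⟫_ℝ
        + ⟪S (α - β) (α - β), S (α - β) γ⟫_ℝ := by
  obtain ⟨ζ, rfl⟩ : ∃ ζ, α = β + ζ := ⟨α - β, by abel⟩
  simp only [add_sub_cancel_left, map_add, hS ζ β, hS γ ζ,
    inner_add_left, inner_add_right, _root_.add_apply,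
    real_inner_comm (S β ζ) (S β γ)]
  ring

theorem abs_inner_apply_le (S : H →L[ℝ] H →L[ℝ] H) (a b c d : H) :
    |⟪S a b, S c d⟫_ℝ| ≤ ‖S‖ ^ 2 * (‖a‖ * ‖b‖ * (‖c‖ * ‖d‖)) := by
  calc |⟪S a b, S c d⟫_ℝ| ≤ ‖S a b‖ * ‖S c d‖ := abs_real_inner_le_norm _ _
    _ ≤ (‖S‖ * ‖a‖ * ‖b‖) * (‖S‖ * ‖c‖ * ‖d‖) := by
        gcongr <;> exact S.le_opNorm₂ _ _
    _ = _ := by ring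

variable [CompleteSpace H]

theorem IsPrimitive.inner {a : ℝ} (ha : 0 ≤ a) {u v u' v' : ℝ → H} (h : IsPrimitive a u v)
    (h' : IsPrimitive a u' v') :
    IsPrimitive a (fun x => ⟪u x, u' x⟫_ℝ) (fun x => ⟪v x, u' x⟫_ℝ + ⟪u x, v' x⟫_ℝ) :=
  h.bilin ((innerₗ H).mkContinuous₂ 1 fun x y => by
    simpa using norm_inner_le_norm (𝕜 := ℝ) x y) h' ha

/-- The energy of the difference of two solutions with the equation
`⟪v_t, K ψ⟫ + D ⟪f, ψ⟫ + D/2 ⟪S f f, S f ψ⟫ = ⟪p, K ψ⟫`. -/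
theorem isPrimitive_energy {a D Λ c : ℝ} (ha : 0 ≤ a) (S : H →L[ℝ] H →L[ℝ] H)
    (hS : ∀ f g, S f g = S g f) (K : H →L[ℝ] H) {α β α' β' y y' q : ℝ → H}
    (hα : IsPrimitive a α α') (hβ : IsPrimitive a β β') (hy : IsPrimitive a y y')
    (hyK : ∀ᵐ t ∂leb a, y t = K (α' t - β' t))
    (heq : ∀ᵐ t ∂leb a, ∀ ψ, ⟪y' t, K ψ⟫_ℝ + D * ⟪α t - β t, ψ⟫_ℝ
      + D / 2 * (⟪S (α t) (α t), S (α t) ψ⟫_ℝ - ⟪S (β t) (β t), S (β t) ψ⟫_ℝ) = ⟪q t, K ψ⟫_ℝ) :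
    IsPrimitive a
      (fun t => 1 / 2 * ‖y t‖ ^ 2 + D * (1 / 2 * ‖α t - β t‖ ^ 2
        + 1 / 8 * (‖S (α t) (α t)‖ ^ 2 - ‖S (β t) (β t)‖ ^ 2
          - 4 * ⟪S (β t) (β t), S (β t) (α t - β t)⟫_ℝ)) + Λ * ‖K (α t - β t)‖ ^ 2 + c)
      (fun t => ⟪q t, y t⟫_ℝ + D / 2 * (2 * ⟪S (β t) (α t - β t), S (α t - β t) (β' t)⟫_ℝ
        + ⟪S (α t - β t) (α t - β t), S (β t) (β' t)⟫_ℝ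
        + ⟪S (α t - β t) (α t - β t), S (α t - β t) (β' t)⟫_ℝ)
        + 2 * Λ * ⟪K (α t - β t), y t⟫_ℝ) := by
  have hζ := hα.sub hβ
  have hKζ := hζ.clm K
  have hSα := hα.bilin S hα ha
  have hSβ := hβ.bilin S hβ ha
  have hSβζ := hβ.bilin S hζ ha
  have e1 := (hy.inner ha hy).const_smul (1 / 2)
  have e2 := (hζ.inner ha hζ).const_smul (1 / 2)
  have e3 := hSα.inner ha hSα
  have e4 := hSβ.inner ha hSβ
  have e5 := (hSβ.inner ha hSβζ).const_smul 4
  have e6 := (((e3.sub e4).sub e5).const_smul (1 / 8))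
  have e7 := (e2.add e6).const_smul D
  have e8 := (hKζ.inner ha hKζ).const_smul Λ
  have e9 := ((e1.add e7).add e8).add (IsPrimitive.const (a := a) c)
  refine e9.congr (fun t _ => ?_) ?_
  · simp only [real_inner_self_eq_norm_sq, smul_eq_mul]
  · filter_upwards [hyK, heq] with t h1 h2
    -- With this test vector `K ψ` is `y t`. All terms with `α'` cancel, leaving the Taylor
    -- remainder in direction `β'`.
    have h3 := h2 (α' t - β' t)
    have h4 := quartic_remainder S hS (α t) (β t) (β' t)
    rw [← h4]
    rw [← h1] at h3 ⊢
    have f1 : ⟪S (α t) (α t), S (α t) (α' t - β' t)⟫_ℝ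
        = ⟪S (α t) (α t), S (α t) (α' t)⟫_ℝ - ⟪S (α t) (α t), S (α t) (β' t)⟫_ℝ := by
      rw [map_sub, inner_sub_right]
    have f2 : ⟪S (β t) (β t), S (β t) (α' t - β' t)⟫_ℝ
        = ⟪S (β t) (β t), S (β t) (α' t)⟫_ℝ - ⟪S (β t) (β t), S (β t) (β' t)⟫_ℝ := by
      rw [map_sub, inner_sub_right]
    rw [f1, f2] at h3
    simp only [smul_eq_mul, hS (α' t) (α t), hS (β' t) (β t), inner_add_left, inner_add_right,
      f2, real_inner_comm (S (α t) (α t)) (S (α t) (α' t)),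
      real_inner_comm (S (β t) (β t)) (S (β t) (β' t)),
      real_inner_comm (y' t) (y t), real_inner_comm (α t - β t) (α' t - β' t),
      real_inner_comm (K (α t - β t)) (y t)]
    linear_combination h3

end Energy

/-! ### Coercivity of the relative energy and time difference quotients. -/

section Regularity

variable {H : Type*} [NormedAddCommGroup H] [InnerProductSpace ℝ H]

/-- In the expansion the square is dropped; the indefinite term is at most a quarter of `‖α - β‖²`
by smallness of `ε`, plus the lower-order term in `k²`. -/
theorem quartic_lower_bound (S : H →L[ℝ] H →L[ℝ] H) (hS : ∀ f g, S f g = S g f) {α β : H}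
    {R ε C k : ℝ} (hR : ‖β‖ ≤ R) (hε : ‖S‖ * R ^ 2 * ε ≤ 1)
    (h : ‖S (α - β) (α - β)‖ ≤ ε * ‖α - β‖ ^ 2 + C * k ^ 2) :
    1 / 4 * ‖α - β‖ ^ 2 - 1 / 4 * (‖S‖ * R ^ 2 * C) * k ^ 2 ≤ 1 / 2 * ‖α - β‖ ^ 2
      + 1 / 8 * (‖S α α‖ ^ 2 - ‖S β β‖ ^ 2 - 4 * ⟪S β β, S β (α - β)⟫_ℝ) := by
  rw [quartic_expansion S hS]
  have h1 := (abs_le.1 (abs_real_inner_le_norm (S β β) (S (α - β) (α - β)))).1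
  have h2 : ‖S β β‖ * ‖S (α - β) (α - β)‖
      ≤ (‖S‖ * R ^ 2) * (ε * ‖α - β‖ ^ 2 + C * k ^ 2) := by
    have : ‖S β β‖ ≤ ‖S‖ * R ^ 2 := by
      calc _ ≤ ‖S‖ * ‖β‖ * ‖β‖ := S.le_opNorm₂ _ _
        _ ≤ ‖S‖ * R * R := by
          have := (norm_nonneg β).trans hR
          gcongr
        _ = _ := by ring
    gcongr
  nlinarith [sq_nonneg ‖(2 : ℝ) • S β (α - β) + S (α - β) (α - β)‖,
    mul_le_mul_of_nonneg_right hε (sq_nonneg ‖α - β‖)]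

theorem quartic_upper_bound (S : H →L[ℝ] H →L[ℝ] H) (hS : ∀ f g, S f g = S g f) {α β : H}
    {R : ℝ} (hR : ‖β‖ ≤ R) (hα : ‖α‖ ≤ R) :
    1 / 2 * ‖α - β‖ ^ 2 + 1 / 8 * (‖S α α‖ ^ 2 - ‖S β β‖ ^ 2 - 4 * ⟪S β β, S β (α - β)⟫_ℝ)
      ≤ (1 / 2 + 3 * ‖S‖ ^ 2 * R ^ 2) * ‖α - β‖ ^ 2 := by
  rw [quartic_expansion S hS]
  have hR0 : 0 ≤ R := (norm_nonneg _).trans hR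
  have hz : ‖α - β‖ ≤ 2 * R := (norm_sub_le _ _).trans (by linarith)
  have h1 : ‖(2 : ℝ) • S β (α - β) + S (α - β) (α - β)‖ ≤ 4 * ‖S‖ * R * ‖α - β‖ := by
    calc _ ≤ 2 * (‖S‖ * ‖β‖ * ‖α - β‖) + ‖S‖ * ‖α - β‖ * ‖α - β‖ := by
          refine (norm_add_le _ _).trans (add_le_add ?_ (S.le_opNorm₂ _ _))
          rw [norm_smul, Real.norm_ofNat]
          gcongr
          exact S.le_opNorm₂ _ _
      _ ≤ 2 * (‖S‖ * R * ‖α - β‖) + ‖S‖ * (2 * R) * ‖α - β‖ := by gcongr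
      _ = _ := by ring
  have h2 : ‖(2 : ℝ) • S β (α - β) + S (α - β) (α - β)‖ ^ 2
      ≤ 16 * (‖S‖ ^ 2 * R ^ 2 * ‖α - β‖ ^ 2) := by
    calc _ ≤ (4 * ‖S‖ * R * ‖α - β‖) ^ 2 := by gcongr
      _ = _ := by ring
  have h3 : ⟪S β β, S (α - β) (α - β)⟫_ℝ ≤ ‖S‖ ^ 2 * R ^ 2 * ‖α - β‖ ^ 2 := by
    refine (le_abs_self _).trans ((abs_inner_apply_le S _ _ _ _).trans ?_)
    calc _ ≤ ‖S‖ ^ 2 * (R * R * (‖α - β‖ * ‖α - β‖)) := by gcongr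
      _ = _ := by ring
  have h4 : 0 ≤ ‖S‖ ^ 2 * R ^ 2 * ‖α - β‖ ^ 2 := by positivity
  nlinarith

theorem quartic_remainder_bound (S : H →L[ℝ] H →L[ℝ] H) {α β γ : H}
    {R : ℝ} (hR : ‖β‖ ≤ R) (hα : ‖α‖ ≤ R) :
    |2 * ⟪S β (α - β), S (α - β) γ⟫_ℝ + ⟪S (α - β) (α - β), S β γ⟫_ℝ
        + ⟪S (α - β) (α - β), S (α - β) γ⟫_ℝ| ≤ 5 * ‖S‖ ^ 2 * R * ‖γ‖ * ‖α - β‖ ^ 2 := by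
  have hR0 : 0 ≤ R := (norm_nonneg _).trans hR
  have hz : ‖α - β‖ ≤ 2 * R := (norm_sub_le _ _).trans (by linarith)
  have h1 : |⟪S β (α - β), S (α - β) γ⟫_ℝ| ≤ ‖S‖ ^ 2 * (R * ‖α - β‖ * (‖α - β‖ * ‖γ‖)) :=
    (abs_inner_apply_le S _ _ _ _).trans (by gcongr)
  have h2 : |⟪S (α - β) (α - β), S β γ⟫_ℝ| ≤ ‖S‖ ^ 2 * (‖α - β‖ * ‖α - β‖ * (R * ‖γ‖)) :=
    (abs_inner_apply_le S _ _ _ _).trans (by gcongr)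
  have h3 : |⟪S (α - β) (α - β), S (α - β) γ⟫_ℝ|
      ≤ ‖S‖ ^ 2 * (‖α - β‖ * ‖α - β‖ * (2 * R * ‖γ‖)) :=
    (abs_inner_apply_le S _ _ _ _).trans (by gcongr)
  calc _ ≤ 2 * |⟪S β (α - β), S (α - β) γ⟫_ℝ| + |⟪S (α - β) (α - β), S β γ⟫_ℝ|
        + |⟪S (α - β) (α - β), S (α - β) γ⟫_ℝ| := by
        refine (abs_add_three _ _ _).trans (le_of_eq ?_)
        rw [abs_mul, abs_two]
    _ ≤ 2 * (‖S‖ ^ 2 * (R * ‖α - β‖ * (‖α - β‖ * ‖γ‖)))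
        + ‖S‖ ^ 2 * (‖α - β‖ * ‖α - β‖ * (R * ‖γ‖))
        + ‖S‖ ^ 2 * (‖α - β‖ * ‖α - β‖ * (2 * R * ‖γ‖)) := by gcongr
    _ = _ := by ring

/-- Each of the three terms is dominated by the energy on its own. Including `m ^ 2 / 2` in the
energy absorbs the load, so the homogeneous Grönwall inequality suffices. -/
theorem energy_rate_le {D Λ σ R γ Y Z N m a b c : ℝ} (hD : 0 ≤ D) (hΛ : 0 ≤ Λ) (hγ : 0 ≤ γ)
    (ha : |a| ≤ m * Y) (hb : |b| ≤ 5 * σ ^ 2 * R * γ * Z ^ 2) (hc : |c| ≤ N * Y) :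
    |a + D / 2 * b + 2 * Λ * c| ≤ (1 + 2 * Λ + 10 * σ ^ 2 * |R| * γ)
      * (1 / 2 * Y ^ 2 + D / 4 * Z ^ 2 + N ^ 2 + m ^ 2 / 2) := by
  set E := 1 / 2 * Y ^ 2 + D / 4 * Z ^ 2 + N ^ 2 + m ^ 2 / 2 with hE
  have t1 : m * Y ≤ E := by
    have : 0 ≤ D / 4 * Z ^ 2 + N ^ 2 := by positivity
    linarith [sq_nonneg (m - Y), sub_sq m Y]
  have t2 : D / 2 * (5 * σ ^ 2 * R * γ * Z ^ 2) ≤ 10 * σ ^ 2 * |R| * γ * E := by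
    have e1 : D / 4 * Z ^ 2 ≤ E := by
      have : 0 ≤ 1 / 2 * Y ^ 2 + N ^ 2 + m ^ 2 / 2 := by positivity
      linarith
    have hRR : R ≤ |R| := le_abs_self R
    calc _ = 10 * σ ^ 2 * R * γ * (D / 4 * Z ^ 2) := by ring
      _ ≤ 10 * σ ^ 2 * |R| * γ * (D / 4 * Z ^ 2) := by gcongr
      _ ≤ _ := by gcongr
  have t3 : 2 * Λ * (N * Y) ≤ 2 * Λ * E := by
    have : N * Y ≤ E := by
      have : 0 ≤ D / 4 * Z ^ 2 + m ^ 2 / 2 := by positivity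
      linarith [sq_nonneg (N - Y), sub_sq N Y, sq_nonneg N]
    gcongr
  refine (abs_add_three _ _ _).trans ?_
  rw [abs_mul (D / 2), abs_of_nonneg (div_nonneg hD zero_le_two), abs_mul (2 * Λ),
    abs_of_nonneg (mul_nonneg zero_le_two hΛ)]
  have s2 := mul_le_mul_of_nonneg_left hb (div_nonneg hD zero_le_two)
  have s3 := mul_le_mul_of_nonneg_left hc (mul_nonneg zero_le_two hΛ)
  have ek : (1 + 2 * Λ + 10 * σ ^ 2 * |R| * γ) * E
      = E + 2 * Λ * E + 10 * σ ^ 2 * |R| * γ * E := by ring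
  rw [ek]
  linarith

theorem ae_leb_shift {T h : ℝ} (h0 : 0 ≤ h) {p : ℝ → Prop} (hp : ∀ᵐ t ∂leb T, p t) :
    ∀ᵐ t ∂leb (T - h), p (t + h) := by
  rw [ae_leb_iff] at hp ⊢
  have h2 := (measurePreserving_add_right volume h).quasiMeasurePreserving.ae hp
  filter_upwards [h2] with t ht htm
  exact ht ⟨by linarith [htm.1], by linarith [htm.2]⟩

theorem ae_leb_mono {T T' : ℝ} (h : T' ≤ T) {p : ℝ → Prop} (hp : ∀ᵐ t ∂leb T, p t) :
    ∀ᵐ t ∂leb T', p t :=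
  ae_restrict_of_ae_restrict_of_subset (Ioo_subset_Ioo_right h) hp

variable [CompleteSpace H]

/-- The relative energy of `f` and its translate by `h` controls the left side from above and is
controlled by the right side at time `s`. Its rate involves only `‖g‖`, not the derivative of the
translate, so the Grönwall factor is bounded uniformly in `h`, `s` and `t`. -/
theorem exists_difference_bound {T D M : ℝ} (hD : 0 < D)
    (S : H →L[ℝ] H →L[ℝ] H) (hS : ∀ f g, S f g = S g f) (K : H →L[ℝ] H)
    (hSK : ∀ ε > 0, ∃ C, ∀ f, ‖S f f‖ ≤ ε * ‖f‖ ^ 2 + C * ‖K f‖ ^ 2) {f g v vt p : ℝ → H}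
    (hf : IsPrimitive T f g) (hv : IsPrimitive T v vt) (hvg : ∀ᵐ t ∂leb T, v t = K (g t))
    (hp : ∀ s ∈ Icc 0 T, ∀ t ∈ Icc 0 T, ‖p t - p s‖ ≤ M * |t - s|)
    (heq : ∀ᵐ t ∂leb T, ∀ ψ, ⟪vt t, K ψ⟫_ℝ + D * ⟪f t, ψ⟫_ℝ
      + D / 2 * ⟪S (f t) (f t), S (f t) ψ⟫_ℝ = ⟪p t, K ψ⟫_ℝ) :
    ∃ A, 0 ≤ A ∧ ∀ h ∈ Ioo 0 T, ∀ s ∈ Icc 0 (T - h), ∀ t ∈ Icc 0 (T - h),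
      ‖v (t + h) - v t‖ ^ 2
        ≤ A * (‖v (s + h) - v s‖ ^ 2 + ‖f (s + h) - f s‖ ^ 2 + h ^ 2) := by
  obtain ⟨R, hR⟩ := isCompact_Icc.exists_bound_of_continuousOn hf.continuousOn
  obtain ⟨C, hC⟩ := hSK ((‖S‖ * R ^ 2 + 1)⁻¹) (by positivity)
  have hε : ‖S‖ * R ^ 2 * (‖S‖ * R ^ 2 + 1)⁻¹ ≤ 1 := by
    rw [← div_eq_mul_inv, div_le_one (by positivity)]
    linarith
  have hC' : ∀ f, ‖S f f‖ ≤ (‖S‖ * R ^ 2 + 1)⁻¹ * ‖f‖ ^ 2 + |C| * ‖K f‖ ^ 2 := fun f =>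
    (hC f).trans (by gcongr; exact le_abs_self _)
  -- The first summand cancels the loss in `quartic_lower_bound`; the extra `1` keeps a full `‖K (f
  -- (t + h) - f t)‖²` in the energy, as `energy_rate_le` requires.
  set Λ : ℝ := D * (1 / 4 * (‖S‖ * R ^ 2 * |C|)) + 1 with hΛ
  have hΛ0 : 0 ≤ Λ := by positivity
  set k : ℝ → ℝ := fun t => 1 + 2 * Λ + 10 * ‖S‖ ^ 2 * |R| * ‖g t‖ with hk
  have hk0 : ∀ t, 0 ≤ k t := fun t => by positivity
  have hki : Integrable k (leb T) :=
    (integrable_const _).add (hf.integrable.norm.const_mul _)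
  set A₀ : ℝ := 1 / 2 + D * (1 / 2 + 3 * ‖S‖ ^ 2 * R ^ 2) + Λ * ‖K‖ ^ 2 + M ^ 2 / 2 with hA₀
  refine ⟨2 * A₀ * Real.exp (∫ t in Ioo 0 T, k t), by positivity, ?_⟩
  intro h hh s hs t ht
  have hb : T - h ≤ T := by linarith [hh.1]
  have hb0 : 0 ≤ T - h := by linarith [hh.2]
  have hfs := hf.shift hh.1.le hh.2.le
  have hvs := hv.shift hh.1.le hh.2.le
  have hf' := hf.mono hb
  have hv' := hv.mono hb
  have hy := hvs.sub hv'
  -- The additive constant is half the square of the Lipschitz bound `M * h` on the load difference.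
  have main := isPrimitive_energy (D := D) (Λ := Λ) (c := (M * h) ^ 2 / 2) hb0 S hS K
    (q := fun t => p (t + h) - p t) hfs hf' hy
    (by
      filter_upwards [ae_leb_mono hb hvg, ae_leb_shift hh.1.le hvg] with t h1 h2
      rw [h1, h2, map_sub])
    (by
      filter_upwards [ae_leb_mono hb heq, ae_leb_shift hh.1.le heq] with t h1 h2 ψ
      have e1 := h1 ψ
      have e2 := h2 ψ
      simp only [inner_sub_left]
      linear_combination e2 - e1)
  set G : ℝ → ℝ := fun t => 1 / 2 * ‖v (t + h) - v t‖ ^ 2 + D * (1 / 2 * ‖f (t + h) - f t‖ ^ 2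
        + 1 / 8 * (‖S (f (t + h)) (f (t + h))‖ ^ 2 - ‖S (f t) (f t)‖ ^ 2
          - 4 * ⟪S (f t) (f t), S (f t) (f (t + h) - f t)⟫_ℝ)) + Λ * ‖K (f (t + h) - f t)‖ ^ 2
          + (M * h) ^ 2 / 2 with hG
  have hRt : ∀ t ∈ Icc 0 (T - h), ‖f t‖ ≤ R ∧ ‖f (t + h)‖ ≤ R := fun t ht =>
    ⟨hR t ⟨ht.1, by linarith [ht.2]⟩, hR _ ⟨by linarith [ht.1, hh.1], by linarith [ht.2]⟩⟩
  have lower : ∀ t ∈ Icc 0 (T - h), 1 / 2 * ‖v (t + h) - v t‖ ^ 2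
      + D / 4 * ‖f (t + h) - f t‖ ^ 2 + ‖K (f (t + h) - f t)‖ ^ 2 + (M * h) ^ 2 / 2 ≤ G t := by
    intro t ht
    have h1 := quartic_lower_bound S hS (hRt t ht).1 hε
      (hC' (f (t + h) - f t))
    have h2 := mul_le_mul_of_nonneg_left h1 hD.le
    simp only [hG, hΛ]
    linarith
  have upper : ∀ t ∈ Icc 0 (T - h),
      G t ≤ A₀ * (‖v (t + h) - v t‖ ^ 2 + ‖f (t + h) - f t‖ ^ 2 + h ^ 2) := by
    intro t ht
    have h1 := quartic_upper_bound S hS (hRt t ht).1 (hRt t ht).2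
    have h2 := mul_le_mul_of_nonneg_left h1 hD.le
    have h3 : ‖K (f (t + h) - f t)‖ ^ 2 ≤ ‖K‖ ^ 2 * ‖f (t + h) - f t‖ ^ 2 := by
      rw [← mul_pow]
      gcongr
      exact K.le_opNorm _
    have h4 := mul_le_mul_of_nonneg_left h3 hΛ0
    have p1 : 1 / 2 ≤ A₀ := by
      have : 0 ≤ D * (1 / 2 + 3 * ‖S‖ ^ 2 * R ^ 2) + Λ * ‖K‖ ^ 2 + M ^ 2 / 2 := by positivity
      linarith
    have p2 : D * (1 / 2 + 3 * ‖S‖ ^ 2 * R ^ 2) + Λ * ‖K‖ ^ 2 ≤ A₀ := by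
      have : 0 ≤ M ^ 2 / 2 := by positivity
      linarith
    have p3 : M ^ 2 / 2 ≤ A₀ := by
      have : 0 ≤ D * (1 / 2 + 3 * ‖S‖ ^ 2 * R ^ 2) + Λ * ‖K‖ ^ 2 := by positivity
      linarith
    have q1 := mul_le_mul_of_nonneg_right p1 (sq_nonneg ‖v (t + h) - v t‖)
    have q2 := mul_le_mul_of_nonneg_right p2 (sq_nonneg ‖f (t + h) - f t‖)
    have q3 := mul_le_mul_of_nonneg_right p3 (sq_nonneg h)
    simp only [hG]
    linarith
  have hGnn : ∀ t ∈ Icc 0 (T - h), 0 ≤ G t := fun t ht => le_trans (by positivity) (lower t ht)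
  have gron := main.gronwall (k := k) (IntegrableOn.mono_set hki (Ioo_subset_Ioo_right hb)) hk0
    hGnn (by
      filter_upwards [ae_mem_Icc] with t ht
      have low := lower t ht
      have hq : ‖p (t + h) - p t‖ ≤ M * h := by
        have := hp t ⟨ht.1, by linarith [ht.2]⟩ (t + h)
          ⟨by linarith [ht.1, hh.1], by linarith [ht.2]⟩
        rwa [add_sub_cancel_left, abs_of_pos hh.1] at this
      have r1 : |⟪p (t + h) - p t, v (t + h) - v t⟫_ℝ| ≤ M * h * ‖v (t + h) - v t‖ :=
        (abs_real_inner_le_norm _ _).trans (by gcongr)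
      have r2 := quartic_remainder_bound S (γ := g t) (hRt t ht).1 (hRt t ht).2
      have r3 := abs_real_inner_le_norm (K (f (t + h) - f t)) (v (t + h) - v t)
      exact (energy_rate_le hD.le hΛ0 (norm_nonneg _) r1 r2 r3).trans
        (mul_le_mul_of_nonneg_left low (hk0 t))) hs ht
  have hexp : Real.exp (∫ x in Ioo 0 (T - h), k x) ≤ Real.exp (∫ x in Ioo 0 T, k x) :=
    Real.exp_le_exp.2 (setIntegral_mono_set hki (Eventually.of_forall hk0)
      (LE.le.eventuallyLE (Ioo_subset_Ioo_right hb)))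
  have f1 : ‖v (t + h) - v t‖ ^ 2 ≤ 2 * G t := by
    have := lower t ht
    have : 0 ≤ D / 4 * ‖f (t + h) - f t‖ ^ 2 + ‖K (f (t + h) - f t)‖ ^ 2
      + (M * h) ^ 2 / 2 := by positivity
    linarith
  calc ‖v (t + h) - v t‖ ^ 2 ≤ 2 * G t := f1
    _ ≤ 2 * (G s * Real.exp (∫ x in Ioo 0 (T - h), k x)) := by gcongr
    _ ≤ 2 * ((A₀ * (‖v (s + h) - v s‖ ^ 2 + ‖f (s + h) - f s‖ ^ 2 + h ^ 2))
          * Real.exp (∫ x in Ioo 0 T, k x)) := by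
        have := upper s hs
        have := hGnn s hs
        gcongr
    _ = _ := by ring

/-- The second time derivative of a regular solution of the abstract equation is bounded. -/
theorem exists_ae_bound_second_derivative {T D M : ℝ} (hT : 0 < T) (hD : 0 < D)
    (S : H →L[ℝ] H →L[ℝ] H) (hS : ∀ f g, S f g = S g f) (K : H →L[ℝ] H)
    (hSK : ∀ ε > 0, ∃ C, ∀ f, ‖S f f‖ ≤ ε * ‖f‖ ^ 2 + C * ‖K f‖ ^ 2) {f g v vt p : ℝ → H}
    (hf : IsPrimitive T f g) (hv : IsPrimitive T v vt) (hvg : ∀ᵐ t ∂leb T, v t = K (g t))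
    (hp : ∀ s ∈ Icc 0 T, ∀ t ∈ Icc 0 T, ‖p t - p s‖ ≤ M * |t - s|)
    (heq : ∀ᵐ t ∂leb T, ∀ ψ, ⟪vt t, K ψ⟫_ℝ + D * ⟪f t, ψ⟫_ℝ
      + D / 2 * ⟪S (f t) (f t), S (f t) ψ⟫_ℝ = ⟪p t, K ψ⟫_ℝ) :
    ∃ C, ∀ᵐ t ∂leb T, ‖vt t‖ ≤ C := by
  obtain ⟨A, hA0, hA⟩ := exists_difference_bound hD S hS K hSK hf hv hvg hp heq
  have hne : (ae (leb T)).NeBot := by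
    rw [ae_neBot, leb, Ne, Measure.restrict_eq_zero, Real.volume_Ioo]
    simpa using hT
  -- One time at which `f` and `v` are both differentiable supplies `O(h)` increments, so no
  -- compatibility of the initial data is needed. The estimate carries these increments from `s` to
  -- earlier and later times alike.
  obtain ⟨s, ⟨hs1, hs2⟩, hsm⟩ := ((hf.ae_hasDerivAt.and hv.ae_hasDerivAt).and
    (ae_restrict_mem measurableSet_Ioo)).exists
  obtain ⟨c1, hc1⟩ := hs1.differentiableAt.isBigO_sub.bound
  obtain ⟨c2, hc2⟩ := hs2.differentiableAt.isBigO_sub.bound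
  obtain ⟨r, hr, hball⟩ := Metric.eventually_nhds_iff.1 (hc1.and hc2)
  set B := A * (c2 ^ 2 + c1 ^ 2 + 1) with hB
  have hB0 : 0 ≤ B := by positivity
  set h₀ := min r (T - s) with hh₀
  have hh0 : 0 < h₀ := lt_min hr (by linarith [hsm.2])
  have key : ∀ h, 0 < h → h < h₀ → ∀ t ∈ Icc 0 (T - h), ‖v (t + h) - v t‖ ≤ √B * h := by
    intro h h1 h2 t ht
    have h3 : h < r := h2.trans_le (min_le_left _ _)
    have h4 : h < T - s := h2.trans_le (min_le_right _ _)
    have hd := hball (y := s + h) (by rw [Real.dist_eq, add_sub_cancel_left, abs_of_pos h1]; exact h3)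
    rw [add_sub_cancel_left, Real.norm_eq_abs h, abs_of_pos h1] at hd
    have m1 := hA h ⟨h1, by linarith [hsm.1]⟩ s ⟨hsm.1.le, by linarith⟩ t ht
    have m2 : ‖v (t + h) - v t‖ ^ 2 ≤ (√B * h) ^ 2 := by
      calc _ ≤ _ := m1
        _ ≤ A * ((c2 * h) ^ 2 + (c1 * h) ^ 2 + h ^ 2) := by
          gcongr
          · exact hd.2
          · exact hd.1
        _ = B * h ^ 2 := by rw [hB]; ring
        _ = _ := by rw [mul_pow, Real.sq_sqrt hB0]
    exact le_of_sq_le_sq m2 (by positivity)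
  refine ⟨√B, ?_⟩
  filter_upwards [hv.ae_hasDerivAt, ae_restrict_mem measurableSet_Ioo] with t ht htm
  refine ht.le_of_lip' (by positivity) ?_
  have e1 : ∀ᶠ x in 𝓝 t, x ∈ Ioo 0 T := Ioo_mem_nhds htm.1 htm.2
  have e2 : ∀ᶠ x in 𝓝 t, |x - t| < h₀ := by
    exact Metric.eventually_nhds_iff.2 ⟨h₀, hh0, fun y hy => hy⟩
  filter_upwards [e1, e2] with x hx hxt
  rcases lt_trichotomy x t with hlt | rfl | hgt
  · rw [abs_of_neg (by linarith)] at hxt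
    have := key (t - x) (by linarith) (by linarith) x ⟨hx.1.le, by linarith [htm.2]⟩
    rw [add_sub_cancel] at this
    rw [norm_sub_rev (v x), norm_sub_rev x, Real.norm_eq_abs, abs_of_pos (by linarith)]
    exact this
  · simp
  · rw [abs_of_pos (by linarith)] at hxt
    have := key (x - t) (by linarith) (by linarith) t ⟨htm.1.le, by linarith [hx.2]⟩
    rw [add_sub_cancel] at this
    rw [Real.norm_eq_abs, abs_of_pos (by linarith)]
    exact this

end Regularity

/-! ### Boundary values and the integration operators. -/

noncomputable section Traces

variable {L : ℝ}

/-- The primitive given by du Bois-Reymond and the representative carrying the trace are both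
continuous, so they agree at `0` and fix the constant of integration. -/
theorem prim_eq_of_hasValueAt (hL : 0 < L) {f g : L2 L} (h : HasWeakDeriv L f g)
    (h0 : HasValueAt L f 0 0) : f = prim L g := by
  obtain ⟨u, hu, hfu⟩ := h.exists_isPrimitive hL (L2.integrable f) (L2.integrable g)
  obtain ⟨r, hr, hfr, hr0⟩ := h0
  have e := eqOn_Icc_of_ae_eq hL hu.continuousOn hr (hfu.symm.trans hfr)
  have hu0 : u 0 = 0 := (e ⟨le_rfl, hL.le⟩).trans hr0
  refine Lp.ext ?_
  filter_upwards [hfu, coe_prim g, ae_mem_Icc] with x h1 h2 hx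
  rw [h1, h2, hu.eq_add x hx, hu0, zero_add]

theorem primR_eq_of_hasValueAt (hL : 0 < L) {f g : L2 L} (h : HasWeakDeriv L f g)
    (h0 : HasValueAt L f L 0) : f = primR L (-g) := by
  obtain ⟨u, hu, hfu⟩ := h.exists_isPrimitive hL (L2.integrable f) (L2.integrable g)
  obtain ⟨r, hr, hfr, hr0⟩ := h0
  have e := eqOn_Icc_of_ae_eq hL hu.continuousOn hr (hfu.symm.trans hfr)
  have hl : L ∈ Icc 0 L := ⟨hL.le, le_rfl⟩
  have hu0 : u L = 0 := (e hl).trans hr0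
  refine Lp.ext ?_
  filter_upwards [hfu, coe_primR (-g), ae_mem_Icc] with x h1 h2 hx
  rw [h1, h2, intervalIntegral_congr_leb (Lp.coeFn_neg g) hx hl]
  have := hu.sub_eq hx hl
  simp only [Pi.neg_apply, intervalIntegral.integral_neg, ← this, hu0]
  ring

theorem hasWeakDeriv_prim (hL : 0 ≤ L) (g : L2 L) : HasWeakDeriv L (prim L g) g :=
  (isPrimitive_L2 g).hasWeakDeriv hL (coe_prim g) (EventuallyEq.refl _ _)

theorem hasValueAt_prim (g : L2 L) : HasValueAt L (prim L g) 0 0 :=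
  ⟨_, (isPrimitive_L2 g).continuousOn, coe_prim g, by simp⟩

theorem hasWeakDeriv_primR (hL : 0 ≤ L) (g : L2 L) : HasWeakDeriv L (primR L (-g)) g := by
  refine (isPrimitive_right hL (L2.integrable (-g))).hasWeakDeriv hL (coe_primR _) ?_
  filter_upwards [Lp.coeFn_neg g] with x hx
  rw [hx]; simp

theorem hasValueAt_primR (hL : 0 ≤ L) (g : L2 L) : HasValueAt L (primR L g) L 0 :=
  ⟨_, (isPrimitive_right hL (L2.integrable g)).continuousOn, coe_primR g, by simp⟩

theorem prim_injective (hL : 0 < L) : Function.Injective (prim L) := by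
  refine (injective_iff_map_eq_zero _).2 fun f hf => ?_
  have h1 : (fun x => ∫ y in (0 : ℝ)..x, f y) =ᵐ[leb L] fun _ => (0 : ℝ) := by
    filter_upwards [coe_prim f, Lp.coeFn_zero ℝ 2 (leb L)] with x h1 h2
    rw [← h1, hf, h2]; rfl
  have h2 := eqOn_Icc_of_ae_eq hL (isPrimitive_L2 f).continuousOn continuousOn_const h1
  have h3 := ((isPrimitive_L2 f).congr h2 (EventuallyEq.refl _ _)).ae_unique
    (IsPrimitive.const 0)
  refine Lp.ext ?_
  filter_upwards [h3, Lp.coeFn_zero ℝ 2 (leb L)] with x h4 h5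
  rw [h4, h5]; rfl

theorem primR_injective (hL : 0 < L) : Function.Injective (primR L) := by
  refine (injective_iff_map_eq_zero _).2 fun f hf => ?_
  have h1 : (fun x => ∫ y in x..L, f y) =ᵐ[leb L] fun _ => (0 : ℝ) := by
    filter_upwards [coe_primR f, Lp.coeFn_zero ℝ 2 (leb L)] with x h1 h2
    rw [← h1, hf, h2]; rfl
  have h0 := isPrimitive_right hL.le (L2.integrable f)
  have h2 := eqOn_Icc_of_ae_eq hL h0.continuousOn continuousOn_const h1
  have h3 := (h0.congr h2 (EventuallyEq.refl _ _)).ae_unique (IsPrimitive.const 0)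
  refine Lp.ext ?_
  filter_upwards [h3, Lp.coeFn_zero ℝ 2 (leb L)] with x h4 h5
  rw [h5, Pi.zero_apply, ← neg_eq_zero, h4]

end Traces

/-! ### The stationary equation: natural boundary conditions, strong form, fourth-derivative bound.
-/

noncomputable section EulerLagrange

variable {D L : ℝ}

theorem hasValueAt_of_isPrimitive {f : ℝ → ℝ} {u v : ℝ → ℝ} (hu : IsPrimitive L u v)
    (h : f =ᵐ[leb L] u) {x c : ℝ} (hx : u x = c) : HasValueAt L f x c :=
  ⟨u, hu.continuousOn, h, hx⟩

/-- The integrated form of the stationary equation: functions `g₁, g₂, g₃` representing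
`w_x, w_xx, w_xxx` and the double primitive of the load satisfy a pointwise identity. -/
theorem integrated_equation (hL : 0 < L) (hD : 0 < D) {f q : L2 L} {g₁ g₂ : ℝ → ℝ}
    (hg₁ : g₁ = fun x => ∫ y in (0 : ℝ)..x, f y) (hg₂ : ContinuousOn g₂ (Icc 0 L))
    (hf : f =ᵐ[leb L] g₂)
    (heq : ∀ ψ, ⟪q, prim L (prim L ψ)⟫_ℝ + D * ⟪f, ψ⟫_ℝ
      + D * ⟪mulPrim L f f, mulPrim L f ψ + mulPrim L ψ f⟫_ℝ = 0) :
    ∀ x ∈ Icc 0 L, g₂ x + g₁ x * g₁ x * g₂ x =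
      -(∫ y in x..L, g₂ y * g₂ y * g₁ y) - D⁻¹ * ∫ y in x..L, ∫ z in y..L, q z := by
  have hl : L ∈ Icc 0 L := ⟨hL.le, le_rfl⟩
  have hc₁ : ContinuousOn g₁ (Icc 0 L) := hg₁ ▸ (isPrimitive_L2 f).continuousOn
  have hcA : ContinuousOn (fun x => g₁ x * g₁ x * g₂ x) (Icc 0 L) := (hc₁.mul hc₁).mul hg₂
  have hcM : ContinuousOn (fun x => g₂ x * g₂ x * g₁ x) (Icc 0 L) := (hg₂.mul hg₂).mul hc₁
  set A : L2 L := (memLp_of_continuousOn hcA).toLp _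
  set M : L2 L := (memLp_of_continuousOn hcM).toLp _
  have hA : A =ᵐ[leb L] fun x => g₁ x * g₁ x * g₂ x := MemLp.coeFn_toLp _
  have hM : M =ᵐ[leb L] fun x => g₂ x * g₂ x * g₁ x := MemLp.coeFn_toLp _
  have hP : mulPrim L f f =ᵐ[leb L] fun x => g₁ x * g₂ x := by
    filter_upwards [coe_mulPrim f f, hf] with x h1 h2
    rw [h1, h2, hg₁]
  -- After every primitive of `ψ` is moved to the other factor by adjointness, `ψ` is a free element
  -- of `L²`, so the vector paired with it vanishes.
  have key : primR L (primR L q) + D • (f + A + primR L M) = 0 := by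
    refine ext_inner_right ℝ fun ψ => ?_
    rw [inner_zero_left, ← heq ψ, inner_add_left, inner_smul_left, conj_trivial, inner_add_left,
      inner_add_left, inner_add_right, real_inner_comm ψ (primR L (primR L q)),
      ← inner_prim_left hL.le, ← inner_prim_left hL.le, real_inner_comm q,
      real_inner_comm ψ (primR L M), ← inner_prim_left hL.le]
    have e1 : ⟪mulPrim L f f, mulPrim L f ψ⟫_ℝ = ⟪A, ψ⟫_ℝ := by
      rw [inner_eq_integral, inner_eq_integral]
      refine integral_congr_ae ?_
      filter_upwards [hP, coe_mulPrim f ψ, hA] with x h1 h2 h3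
      rw [h1, h2, h3, hg₁]; ring
    have e2 : ⟪mulPrim L f f, mulPrim L ψ f⟫_ℝ = ⟪prim L ψ, M⟫_ℝ := by
      rw [inner_eq_integral, inner_eq_integral]
      refine integral_congr_ae ?_
      filter_upwards [hP, coe_mulPrim ψ f, hM, coe_prim ψ, hf] with x h1 h2 h3 h4 h5
      rw [h1, h2, h3, h4, h5]; ring
    rw [e1, e2]; ring
  have hq1 := isPrimitive_right hL.le (L2.integrable q)
  have hq1i : Integrable (fun x => ∫ y in x..L, q y) (leb L) :=
    (hq1.continuousOn.integrableOn_Icc).mono_set Ioo_subset_Icc_self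
  have hMi : Integrable (fun x => g₂ x * g₂ x * g₁ x) (leb L) :=
    (hcM.integrableOn_Icc).mono_set Ioo_subset_Icc_self
  refine eqOn_Icc_of_ae_eq hL (hg₂.add hcA)
    (((isPrimitive_right hL.le hMi).continuousOn.neg).sub
      ((isPrimitive_right hL.le hq1i).continuousOn.const_smul D⁻¹)) ?_
  have hz : ((primR L (primR L q) + D • (f + A + primR L M) : L2 L) : ℝ → ℝ) =ᵐ[leb L] 0 := by
    rw [key]; exact Lp.coeFn_zero ..
  filter_upwards [hz, Lp.coeFn_add (primR L (primR L q)) (D • (f + A + primR L M)),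
    Lp.coeFn_smul D (f + A + primR L M), Lp.coeFn_add (f + A) (primR L M), Lp.coeFn_add f A,
    hf, hA, coe_primR M, coe_primR (primR L q), ae_mem_Icc] with x h1 h2 h3 h4 h5 h6 h7 h8 h9 hx
  rw [h1, Pi.add_apply, h3, Pi.smul_apply, h4, Pi.add_apply, h5, Pi.add_apply, h6, h7, h8, h9,
    intervalIntegral_congr_leb hM hx hl, intervalIntegral_congr_leb (coe_primR q) hx hl] at h2
  simp only [Pi.zero_apply, smul_eq_mul] at h2 ⊢
  have hDD : D⁻¹ * D = 1 := inv_mul_cancel₀ hD.ne'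
  linear_combination (-D⁻¹) * h2 - (g₂ x + g₁ x * g₁ x * g₂ x + ∫ y in x..L, g₂ y * g₂ y * g₁ y) * hDD

/-- A bound for `w_xxxx` in terms of bounds for the load and for `w_xx`. -/
def fourthDerivBound (D L Q F : ℝ) : ℝ :=
  let c := ‖one L‖
  let B₂ := c * F * F ^ 2 + D⁻¹ * (c * Q * L)
  let B₃ := D⁻¹ * (c * Q) + c * F * B₂ ^ 2
  D⁻¹ * Q + (B₂ ^ 3 + 4 * (c * F) * B₂ * B₃) * c

theorem abs_le_abs_one_add_mul_self_mul (a b : ℝ) : |b| ≤ |(1 + a * a) * b| := by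
  rw [abs_mul, abs_of_pos (by nlinarith [mul_self_nonneg a] : 0 < 1 + a * a)]
  nlinarith [mul_nonneg (mul_self_nonneg a) (abs_nonneg b)]

/-- A bootstrap on the integrated identity for `(1 + g₁²) g₂`. Its right side vanishes at `L`, and
so does that of its derivative once `g₂ L = 0` is known; the second derivative is the equation.
Dividing by `1 + g₁² ≥ 1` at each stage bounds `g₂`, `g₃` and `f''` in turn. -/
theorem stationary_regularity (hL : 0 < L) (hD : 0 < D) {f f' f'' q : L2 L}
    (h2 : HasWeakDeriv L f f') (h3 : HasWeakDeriv L f' f'')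
    (heq : ∀ ψ, ⟪q, prim L (prim L ψ)⟫_ℝ + D * ⟪f, ψ⟫_ℝ
      + D * ⟪mulPrim L f f, mulPrim L f ψ + mulPrim L ψ f⟫_ℝ = 0) :
    (HasValueAt L f L 0 ∧ HasValueAt L f' L 0) ∧
    (∃ n₁ m n₂ : L2 L,
      HasWeakDeriv L (fun x => f x ^ 2 * prim L f x) n₁ ∧
      HasWeakDeriv L (fun x => f x * prim L f x ^ 2) m ∧
      HasWeakDeriv L m n₂ ∧
      ∀ᵐ x ∂(leb L), q x + D * f'' x - D * n₁ x + D * n₂ x = 0) ∧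
    ∀ Q F, ‖q‖ ≤ Q → ‖f‖ ≤ F → ‖f''‖ ≤ fourthDerivBound D L Q F := by
  have hl : L ∈ Icc 0 L := ⟨hL.le, le_rfl⟩
  obtain ⟨g₂, hg₂', hfg⟩ := h2.exists_isPrimitive hL (L2.integrable f) (L2.integrable f')
  obtain ⟨g₃, hg₃, hfg'⟩ := h3.exists_isPrimitive hL (L2.integrable f') (L2.integrable f'')
  have hg₂ : IsPrimitive L g₂ g₃ := hg₂'.congr (fun _ _ => rfl) hfg'
  obtain ⟨g₁, hg₁⟩ : ∃ g₁ : ℝ → ℝ, g₁ = fun x => ∫ y in (0 : ℝ)..x, f y := ⟨_, rfl⟩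
  have hp₁ : IsPrimitive L g₁ g₂ := (hg₁ ▸ isPrimitive_L2 f).congr (fun _ _ => rfl) hfg
  have hprim : prim L f =ᵐ[leb L] g₁ := hg₁ ▸ coe_prim f
  have hN := integrated_equation hL hD hg₁ hg₂.continuousOn hfg heq
  have c₁ := hp₁.continuousOn
  have c₂ := hg₂.continuousOn
  have c₃ := hg₃.continuousOn
  have hpM := (hg₂.mul hg₂ hL.le).mul hp₁ hL.le
  have hq1 := isPrimitive_right hL.le (L2.integrable q)
  have hq1i : Integrable (fun x => ∫ y in x..L, q y) (leb L) :=
    (hq1.continuousOn.integrableOn_Icc).mono_set Ioo_subset_Icc_self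
  have hMi : Integrable (fun x => g₂ x * g₂ x * g₁ x) (leb L) :=
    (hpM.continuousOn.integrableOn_Icc).mono_set Ioo_subset_Icc_self
  have hA := (hp₁.mul hp₁ hL.le).mul hg₂ hL.le
  have hN1 := hg₂.add hA
  have hN2 := ((isPrimitive_right hL.le hMi).const_smul (-1)).sub
    ((isPrimitive_right hL.le hq1i).const_smul D⁻¹)
  have hpm := (((hp₁.mul hg₂ hL.le).mul hg₂ hL.le).const_smul 2).add
    ((hp₁.mul hp₁ hL.le).mul hg₃ hL.le)
  have hN'1 := hg₃.add hpm
  have hN'2 := hpM.add (hq1.const_smul D⁻¹)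
  -- The first derivative of the integrated identity. Both sides are continuous, so it holds at `x =
  -- L` too.
  have hN' : EqOn (fun x => g₃ x + ((2 : ℝ) • (g₁ x * g₂ x * g₂ x) + g₁ x * g₁ x * g₃ x))
      (fun x => g₂ x * g₂ x * g₁ x + D⁻¹ • ∫ y in x..L, q y) (Icc 0 L) := by
    refine eqOn_Icc_of_ae_eq hL hN'1.continuousOn hN'2.continuousOn ?_
    have := hN1.ae_unique (hN2.congr (v' := _) (fun x hx => by
      simp only [smul_eq_mul]; rw [hN x hx]; ring) (EventuallyEq.refl _ _))
    filter_upwards [this] with x hx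
    simp only [smul_eq_mul] at hx ⊢
    linear_combination hx
  have hv₂ : g₂ L = 0 := by
    have := hN L hl
    simp only [intervalIntegral.integral_same] at this
    have h4 : g₂ L * (1 + g₁ L * g₁ L) = 0 := by linear_combination this
    exact (mul_eq_zero.1 h4).resolve_right (by nlinarith [mul_self_nonneg (g₁ L)])
  have hv₃ : g₃ L = 0 := by
    have := hN' hl
    simp only [intervalIntegral.integral_same, hv₂] at this
    have h4 : g₃ L * (1 + g₁ L * g₁ L) = 0 := by
      simp only [mul_zero, zero_mul, smul_zero] at this
      linear_combination this
    exact (mul_eq_zero.1 h4).resolve_right (by nlinarith [mul_self_nonneg (g₁ L)])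
  have hN'' := hN'1.ae_unique (hN'2.congr hN'.symm (EventuallyEq.refl _ _))
  refine ⟨⟨hasValueAt_of_isPrimitive hg₂ hfg hv₂, hasValueAt_of_isPrimitive hg₃ hfg' hv₃⟩,
    ?_, ?_⟩
  · have cn₁ := (((c₃.mul c₂).add (c₂.mul c₃)).mul c₁).add ((c₂.mul c₂).mul c₂)
    have cm := (((c₁.mul c₂).mul c₂).const_smul (2 : ℝ)).add ((c₁.mul c₁).mul c₃)
    have cr := (((((c₂.mul c₂).add (c₁.mul c₃)).mul c₂).add ((c₁.mul c₂).mul c₃)).const_smul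
      (2 : ℝ)).add (((c₂.mul c₁).add (c₁.mul c₂)).mul c₃)
    have ln₂ := (memLp_of_continuousOn cr).add (memLp_mul_of_bound (c₁.mul c₁) f'')
    refine ⟨(memLp_of_continuousOn cn₁).toLp _, (memLp_of_continuousOn cm).toLp _, ln₂.toLp _,
      ?_, ?_, ?_, ?_⟩
    · refine hpM.hasWeakDeriv hL.le ?_ (MemLp.coeFn_toLp _)
      filter_upwards [hfg, hprim] with x h1 h2
      rw [h1, h2]; ring
    · have hA' : IsPrimitive L (fun x => g₁ x * g₁ x * g₂ x) _ := hA
      refine hA.hasWeakDeriv hL.le ?_ ?_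
      · filter_upwards [hfg, hprim] with x h1 h2
        rw [h1, h2]; ring
      · filter_upwards [MemLp.coeFn_toLp (memLp_of_continuousOn cm)] with x h1
        rw [h1]
        simp only [Pi.add_apply, Pi.mul_apply, Pi.smul_apply, smul_eq_mul]
        ring
    · refine hpm.hasWeakDeriv hL.le (MemLp.coeFn_toLp _) ?_
      filter_upwards [MemLp.coeFn_toLp ln₂] with x h1
      rw [h1]
      simp only [Pi.add_apply, Pi.mul_apply, Pi.smul_apply, smul_eq_mul]
      ring
    · filter_upwards [hN'', MemLp.coeFn_toLp ln₂, MemLp.coeFn_toLp (memLp_of_continuousOn cn₁)]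
        with x h1 h2 h3
      rw [h2, h3]
      simp only [Pi.add_apply, Pi.mul_apply, Pi.smul_apply, smul_eq_mul] at h1 ⊢
      have hDD : D * D⁻¹ = 1 := mul_inv_cancel₀ hD.ne'
      linear_combination D * h1 - q x * hDD
  · intro Q F hQ hF
    set c := ‖one L‖ with hc
    have hc0 : 0 ≤ c := norm_nonneg _
    have hQ0 : 0 ≤ Q := (norm_nonneg _).trans hQ
    have hF0 : 0 ≤ F := (norm_nonneg _).trans hF
    have hDi : 0 < D⁻¹ := inv_pos.2 hD
    obtain ⟨B₂, hB₂⟩ : ∃ B₂, B₂ = c * F * F ^ 2 + D⁻¹ * (c * Q * L) := ⟨_, rfl⟩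
    obtain ⟨B₃, hB₃⟩ : ∃ B₃, B₃ = D⁻¹ * (c * Q) + c * F * B₂ ^ 2 := ⟨_, rfl⟩
    have hB₂0 : 0 ≤ B₂ := by rw [hB₂]; positivity
    have b₁ : ∀ x ∈ Icc 0 L, |g₁ x| ≤ c * F := fun x hx => by
      rw [hg₁]
      exact (abs_primitive_le f hx).trans (by gcongr)
    have bq : ∀ x ∈ Icc 0 L, |∫ y in x..L, q y| ≤ c * Q := fun x hx =>
      (abs_intervalIntegral_le (L2.integrable q) hx hl).trans
        ((integral_abs_le q).trans (by gcongr))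
    -- Only the `L²` norm of `f` and the sup of `g₁` enter here, so the sup bound on `g₂` drawn from
    -- it is not circular.
    have bM : ∀ x ∈ Icc 0 L, |∫ y in x..L, g₂ y * g₂ y * g₁ y| ≤ c * F * F ^ 2 := fun x hx => by
      refine (abs_intervalIntegral_le hMi hx hl).trans ?_
      have e : ∫ t in Ioo 0 L, |g₂ t * g₂ t * g₁ t| ≤ ∫ t in Ioo 0 L, c * F * (f t * f t) := by
        refine integral_mono_ae hMi.norm ((integrable_mul_L2 f f).const_mul _) ?_
        filter_upwards [hfg, ae_mem_Icc] with t ht htm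
        rw [ht, abs_mul, abs_mul_self, mul_comm (c * F)]
        exact mul_le_mul_of_nonneg_left (b₁ t htm) (mul_self_nonneg _)
      refine e.trans ?_
      rw [integral_const_mul, ← inner_eq_integral, real_inner_self_eq_norm_sq]
      gcongr
    have b₂ : ∀ x ∈ Icc 0 L, |g₂ x| ≤ B₂ := fun x hx => by
      have i1 : |∫ y in x..L, ∫ z in y..L, q z| ≤ c * Q * L := by
        have := intervalIntegral.norm_integral_le_of_norm_le_const (a := x) (b := L)
          (f := fun y => ∫ z in y..L, q z) (C := c * Q) fun y hy => by
            rw [uIoc_of_le hx.2] at hy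
            exact bq y ⟨hx.1.trans hy.1.le, hy.2⟩
        refine this.trans ?_
        rw [abs_of_nonneg (by linarith [hx.2])]
        have := hx.1
        gcongr
        linarith
      have i2 : |g₂ x + g₁ x * g₁ x * g₂ x| ≤ B₂ := by
        rw [hN x hx, hB₂]
        refine (abs_sub _ _).trans ?_
        rw [abs_neg, abs_mul, abs_of_pos hDi]
        gcongr
        exact bM x hx
      refine le_trans ?_ i2
      have : g₂ x + g₁ x * g₁ x * g₂ x = (1 + g₁ x * g₁ x) * g₂ x := by ring
      rw [this]
      exact abs_le_abs_one_add_mul_self_mul _ _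
    have b₃ : ∀ x ∈ Icc 0 L, |g₃ x| ≤ B₃ := fun x hx => by
      have i1 : (1 + g₁ x * g₁ x) * g₃ x = D⁻¹ * (∫ y in x..L, q y) - g₁ x * g₂ x ^ 2 := by
        have := hN' hx
        simp only [smul_eq_mul] at this
        linear_combination this
      have i2 : |(1 + g₁ x * g₁ x) * g₃ x| ≤ B₃ := by
        rw [i1, hB₃]
        refine (abs_sub _ _).trans ?_
        rw [abs_mul, abs_mul, abs_of_pos hDi, abs_pow]
        have := bq x hx
        have := b₁ x hx
        have := b₂ x hx
        gcongr
      exact (abs_le_abs_one_add_mul_self_mul _ _).trans i2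
    have b₄ : ∀ᵐ x ∂leb L, |f'' x| ≤ D⁻¹ * |q x| + (B₂ ^ 3 + 4 * (c * F) * B₂ * B₃) := by
      filter_upwards [hN'', ae_mem_Icc] with x h1 hx
      have i1 : (1 + g₁ x * g₁ x) * f'' x
          = -(D⁻¹ * q x) - g₂ x ^ 3 - 4 * g₁ x * g₂ x * g₃ x := by
        simp only [smul_eq_mul] at h1
        linear_combination h1
      have i2 : |(1 + g₁ x * g₁ x) * f'' x|
          ≤ D⁻¹ * |q x| + (B₂ ^ 3 + 4 * (c * F) * B₂ * B₃) := by
        rw [i1]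
        refine (abs_sub _ _).trans ?_
        have j1 : |-(D⁻¹ * q x) - g₂ x ^ 3| ≤ D⁻¹ * |q x| + B₂ ^ 3 := by
          refine (abs_sub _ _).trans ?_
          rw [abs_neg, abs_mul, abs_of_pos hDi, abs_pow]
          have := b₂ x hx
          gcongr
        have j2 : |4 * g₁ x * g₂ x * g₃ x| ≤ 4 * (c * F) * B₂ * B₃ := by
          rw [abs_mul, abs_mul, abs_mul, abs_of_pos (four_pos : (0 : ℝ) < 4)]
          have := b₁ x hx
          have := b₂ x hx
          have := b₃ x hx
          gcongr
        linarith
      exact (abs_le_abs_one_add_mul_self_mul _ _).trans i2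
    have hB₃0 : 0 ≤ B₃ := by rw [hB₃]; positivity
    set B := B₂ ^ 3 + 4 * (c * F) * B₂ * B₃ with hB
    have hB0 : 0 ≤ B := by positivity
    have hle : ‖f''‖ ≤ ‖D⁻¹ • |q| + B • one L‖ := by
      refine Lp.norm_le_norm_of_ae_le ?_
      filter_upwards [b₄, Lp.coeFn_add (D⁻¹ • |q|) (B • one L), Lp.coeFn_smul D⁻¹ |q|,
        Lp.coeFn_abs q, Lp.coeFn_smul B (one L), coe_one (L := L)] with x h1 h2 h3 h4 h5 h6
      rw [h2, Pi.add_apply, h3, h5, Pi.smul_apply, Pi.smul_apply, h4, h6, smul_eq_mul, smul_eq_mul,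
        mul_one, Real.norm_eq_abs, Real.norm_eq_abs,
        abs_of_nonneg (add_nonneg (mul_nonneg hDi.le (abs_nonneg _)) hB0)]
      exact h1
    refine hle.trans ((norm_add_le _ _).trans ?_)
    rw [norm_smul, norm_smul, norm_abs_eq_norm, Real.norm_eq_abs, Real.norm_eq_abs,
      abs_of_pos hDi, abs_of_nonneg hB0]
    have : fourthDerivBound D L Q F = D⁻¹ * Q + B * c := by
      rw [hB, hB₃, hB₂, hc]; rfl
    rw [this]
    gcongr

end EulerLagrange

/-! ### Weak time derivatives of vector-valued functions. -/

section WeakTimeDerivative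

variable {E F : Type*} [NormedAddCommGroup E] [NormedSpace ℝ E] [CompleteSpace E]
  [NormedAddCommGroup F] [NormedSpace ℝ F] [CompleteSpace F]

theorem HasWeakTimeDeriv.of_injective {T : ℝ} {f g : ℝ → E} (A : E →L[ℝ] F)
    (hA : Function.Injective A) (hf : Integrable f (leb T)) (hg : Integrable g (leb T))
    (h : HasWeakTimeDeriv T (fun t => A (f t)) (fun t => A (g t))) : HasWeakTimeDeriv T f g := by
  intro η hη
  apply hA
  rw [map_neg, ← A.integral_comp_comm (hη.isTest_deriv.integrable_smul hf),
    ← A.integral_comp_comm (hη.integrable_smul hg)]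
  simpa using h η hη

theorem HasWeakTimeDeriv.congr {T : ℝ} {f g f' g' : ℝ → E} (h : HasWeakTimeDeriv T f g)
    (hf : f =ᵐ[leb T] f') (hg : g =ᵐ[leb T] g') : HasWeakTimeDeriv T f' g' := by
  intro η hη
  have e1 : ∫ t in Ioo 0 T, deriv η t • f' t = ∫ t in Ioo 0 T, deriv η t • f t := by
    refine integral_congr_ae ?_
    filter_upwards [hf] with t ht
    rw [ht]
  have e2 : ∫ t in Ioo 0 T, η t • g' t = ∫ t in Ioo 0 T, η t • g t := by
    refine integral_congr_ae ?_
    filter_upwards [hg] with t ht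
    rw [ht]
  rw [e1, e2, h η hη]

/-- The first derivative agrees almost everywhere with a continuous function on `[0, T]`, hence is
essentially bounded. The load enters the estimates only through this. -/
theorem exists_lipschitz_of_second_derivative {T : ℝ} (hT : 0 < T) {p pt ptt : ℝ → E}
    (hp : Integrable p (leb T)) (hpt : Integrable pt (leb T)) (hptt : Integrable ptt (leb T))
    (h1 : HasWeakTimeDeriv T p pt) (h2 : HasWeakTimeDeriv T pt ptt) :
    ∃ (r : ℝ → E) (M : ℝ), p =ᵐ[leb T] r ∧ ContinuousOn r (Icc 0 T) ∧
      ∀ s ∈ Icc 0 T, ∀ t ∈ Icc 0 T, ‖r t - r s‖ ≤ M * |t - s| := by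
  obtain ⟨r, hr, hpr⟩ := h1.exists_isPrimitive hT hp hpt
  obtain ⟨q, hq, hpq⟩ := h2.exists_isPrimitive hT hpt hptt
  obtain ⟨M, hM⟩ := isCompact_Icc.exists_bound_of_continuousOn hq.continuousOn
  refine ⟨r, M, hpr, hr.continuousOn, fun s hs t ht => ?_⟩
  rw [(hr.congr (fun _ _ => rfl) hpq).sub_eq hs ht]
  exact intervalIntegral.norm_integral_le_of_norm_le_const fun x hx =>
    hM x (uIcc_subset_Icc hs ht (uIoc_subset_uIcc hx))

end WeakTimeDerivative

/-! ### Weak time derivatives seen through a dual space. -/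

section Embedding

variable {V H : Type*} [NormedAddCommGroup V] [NormedSpace ℝ V] (S : Submodule ℝ V)
  [NormedAddCommGroup H] [InnerProductSpace ℝ H] [CompleteSpace H]

/-- The map `H → S'` induced by a bounded operator `A : S → H`, sending `f` to `φ ↦ (f, A φ)`. -/
noncomputable def embDual (A : S →L[ℝ] H) : H →L[ℝ] StrongDual ℝ S :=
  LinearMap.mkContinuous
    { toFun := fun f => (innerSL ℝ f).comp A
      map_add' := fun f g => by ext φ; simp
      map_smul' := fun c f => by ext φ; simp }
    ‖A‖ fun f => by
    refine (ContinuousLinearMap.opNorm_comp_le _ _).trans (le_of_eq ?_)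
    rw [innerSL_apply_norm, mul_comm]

theorem HasWeakTimeDeriv.of_innerSL_comp {T : ℝ} (A : S →L[ℝ] H)
    (hA : ∀ f, (innerSL ℝ f).comp A = 0 → f = 0) {f g : ℝ → H}
    (hf : Integrable f (leb T)) (hg : Integrable g (leb T))
    (h : HasWeakTimeDeriv T (fun t => (innerSL ℝ (f t)).comp A)
      (fun t => (innerSL ℝ (g t)).comp A)) :
    HasWeakTimeDeriv T f g := by
  have hB : Function.Injective (embDual S A) := (injective_iff_map_eq_zero _).2 hA
  have h' : HasWeakTimeDeriv T (fun t => embDual S A (f t)) (fun t => embDual S A (g t)) := h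
  exact @HasWeakTimeDeriv.of_injective H (StrongDual ℝ S) _ _ _ _ _ _ T f g (embDual S A)
    hB hf hg h'

end Embedding

/-! ### From weak solutions to the equation for `w_xx`. -/

noncomputable section Solutions

variable {D L T : ℝ}

theorem memLp_integrable {E : Type*} [NormedAddCommGroup E] {f : ℝ → E}
    (h : MemLp f 2 (leb T)) : Integrable f (leb T) :=
  h.integrable (by norm_num)

/-- The weak derivative `∂_x^k` as a bounded operator `H^m(0, L) → L²(0, L)`. -/
def derivCLM (L : ℝ) (m : ℕ) (k : Fin (m + 1)) : Sob L m →L[ℝ] L2 L :=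
  (PiLp.proj 2 (fun _ : Fin (m + 1) => L2 L) k).comp (sobolev L m).subtypeL

theorem d_one_of_mem_H2star (hL : 0 < L) {v : Sob L 2} (hv : v ∈ H2star L) :
    v.d 1 = prim L (v.d 2) :=
  prim_eq_of_hasValueAt hL (v.2 1) hv.2

theorem d_zero_of_mem_H2star (hL : 0 < L) {v : Sob L 2} (hv : v ∈ H2star L) :
    v.d 0 = prim L (prim L (v.d 2)) := by
  rw [← d_one_of_mem_H2star hL hv]
  exact prim_eq_of_hasValueAt hL (v.2 0) hv.1

/-- The element of `H²_*` with a prescribed second derivative. -/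
def ofSecondDeriv (hL : 0 ≤ L) (ψ : L2 L) : H2star L :=
  ⟨⟨WithLp.toLp 2 ![prim L (prim L ψ), prim L ψ, ψ], by
      intro k
      fin_cases k
      · exact hasWeakDeriv_prim hL _
      · exact hasWeakDeriv_prim hL _⟩,
    hasValueAt_prim _, hasValueAt_prim _⟩

/-- The range of `prim ∘ prim` is dense because its adjoint `primR ∘ primR` is injective. Identities
in the dual of `H²_*` therefore determine elements of `L²`. -/
theorem eq_zero_of_inner_prim_prim (hL : 0 < L) {f : L2 L}
    (h : ∀ ψ, ⟪f, prim L (prim L ψ)⟫_ℝ = 0) : f = 0 := by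
  have h1 : primR L (primR L f) = primR L (primR L 0) := by
    rw [map_zero, map_zero]
    refine ext_inner_left ℝ fun ψ => ?_
    rw [← inner_prim_left hL.le, ← inner_prim_left hL.le, real_inner_comm, h ψ, inner_zero_right]
  exact primR_injective hL (primR_injective hL h1)

theorem HasWeakTimeDeriv.of_toDual (hL : 0 < L) {f g : ℝ → L2 L} (hf : Integrable f (leb T))
    (hg : Integrable g (leb T))
    (h : HasWeakTimeDeriv T (fun t => toDual (f t)) (fun t => toDual (g t))) :
    HasWeakTimeDeriv T f g := by
  refine HasWeakTimeDeriv.of_innerSL_comp (H2star L) _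
    (fun f hf => eq_zero_of_inner_prim_prim hL fun ψ => ?_) hf hg h
  have := congrArg (fun F => F (ofSecondDeriv hL.le ψ)) hf
  exact this

variable {p : ℝ → L2 L} {w0 : H2star L} {w1 : L2 L}
  {w : ℝ → Sob L 4} {wt : ℝ → H2star L} {wtt : ℝ → L2 L}

theorem IsH4WeakSolution.weak_equation (hL : 0 < L)
    (h : IsH4WeakSolution D L T p w0 w1 w wt wtt) :
    ∀ᵐ t ∂leb T, ∀ ψ : L2 L, ⟪wtt t - p t, prim L (prim L ψ)⟫_ℝ + D * ⟪(w t).d 2, ψ⟫_ℝ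
      + D * ⟪mulPrim L ((w t).d 2) ((w t).d 2),
          mulPrim L ((w t).d 2) ψ + mulPrim L ψ ((w t).d 2)⟫_ℝ = 0 := by
  have : Fact ((2 : ENNReal) ≠ ⊤) := ⟨by simp⟩
  -- The exceptional null set of the weak form depends on the test function. A countable dense set
  -- of `ψ` gives a common one, and continuity in `ψ` covers the rest.
  obtain ⟨s, hsc, hsd⟩ := TopologicalSpace.exists_countable_dense (L2 L)
  have key : ∀ᵐ t ∂leb T, ∀ ψ ∈ s, ⟪wtt t - p t, prim L (prim L ψ)⟫_ℝ + D * ⟪(w t).d 2, ψ⟫_ℝ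
      + D * ⟪mulPrim L ((w t).d 2) ((w t).d 2),
          mulPrim L ((w t).d 2) ψ + mulPrim L ψ ((w t).d 2)⟫_ℝ = 0 := by
    refine (ae_ball_iff hsc).2 fun ψ _ => ?_
    filter_upwards [h.weak.weak_form (ofSecondDeriv hL.le ψ), h.weak.mem_H2star] with t h1 h2
    have hd := d_one_of_mem_H2star hL h2
    set f : L2 L := (w t).d 2 with hf
    change (w t).d 1 = prim L f at hd
    have h3 : ⟪wtt t, prim L (prim L ψ)⟫_ℝ + D * (∫ x in Ioo 0 L, f x * ψ x)
        + D * (∫ x in Ioo 0 L, (f x * (w t).d 1 x) * ((w t).d 1 x * ψ x))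
        + D * (∫ x in Ioo 0 L, (f x * (w t).d 1 x) * (f x * prim L ψ x))
        = ∫ x in Ioo 0 L, p t x * prim L (prim L ψ) x := h1
    rw [hd, ← inner_eq_integral, ← inner_eq_integral] at h3
    have hP : mulPrim L f f =ᵐ[leb L] fun x => f x * prim L f x := by
      filter_upwards [coe_mulPrim f f, coe_prim f] with x e1 e2
      rw [e1, e2, mul_comm]
    have e1 : ∫ x in Ioo 0 L, (f x * prim L f x) * (prim L f x * ψ x)
        = ⟪mulPrim L f f, mulPrim L f ψ⟫_ℝ := by
      rw [inner_eq_integral]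
      refine integral_congr_ae ?_
      filter_upwards [hP, coe_mulPrim f ψ, coe_prim f] with x e1 e2 e3
      rw [e1, e2, e3]
    have e2 : ∫ x in Ioo 0 L, (f x * prim L f x) * (f x * prim L ψ x)
        = ⟪mulPrim L f f, mulPrim L ψ f⟫_ℝ := by
      rw [inner_eq_integral]
      refine integral_congr_ae ?_
      filter_upwards [hP, coe_mulPrim ψ f, coe_prim ψ] with x e1 e2 e3
      rw [e1, e2, e3, mul_comm (f x) (∫ y in (0 : ℝ)..x, ψ y)]
    rw [e1, e2] at h3
    rw [inner_sub_left, inner_add_right]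
    linarith
  filter_upwards [key] with t ht ψ
  refine hsd.induction (P := fun ψ => ⟪wtt t - p t, prim L (prim L ψ)⟫_ℝ + D * ⟪(w t).d 2, ψ⟫_ℝ
      + D * ⟪mulPrim L ((w t).d 2) ((w t).d 2),
          mulPrim L ((w t).d 2) ψ + mulPrim L ψ ((w t).d 2)⟫_ℝ = 0) ht ?_ ψ
  exact isClosed_eq (by fun_prop) continuous_const

theorem IsH4WeakSolution.isStrongSolution (hL : 0 < L) (hD : 0 < D)
    (h : IsH4WeakSolution D L T p w0 w1 w wt wtt) : IsStrongSolution D L T p w0 w1 w wt wtt := by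
  refine ⟨h, ?_⟩
  filter_upwards [h.weak_equation hL, h.weak.mem_H2star] with t h1 h2
  have h3 := (stationary_regularity hL hD ((w t).2 2) ((w t).2 3) h1).1
  exact ⟨h2.1, h2.2, h3.1, h3.2⟩

theorem IsH4WeakSolution.satisfiesPDE (hL : 0 < L) (hD : 0 < D)
    (h : IsH4WeakSolution D L T p w0 w1 w wt wtt) : SatisfiesPDE D L T p w wtt := by
  filter_upwards [h.weak_equation hL, h.weak.mem_H2star] with t h1 h2
  obtain ⟨n₁, m, n₂, k1, k2, k3, k4⟩ :=
    (stationary_regularity hL hD ((w t).2 2) ((w t).2 3) h1).2.1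
  have hd : (w t).d 1 = prim L ((w t).d 2) := d_one_of_mem_H2star hL h2
  rw [hd]
  refine ⟨n₁, m, n₂, k1, k2, k3, ?_⟩
  filter_upwards [k4, Lp.coeFn_sub (wtt t) (p t)] with x h3 h4
  rw [h4, Pi.sub_apply] at h3
  have h5 : (w t).1 (Fin.succ 3) = (w t).d 4 := rfl
  rw [h5] at h3
  linarith

theorem integrable_d_of_memLp {v : ℝ → H2star L} (h : MemLp v 2 (leb T)) (k : Fin 3) :
    Integrable (fun t => (v t).1.d k) (leb T) := by
  have h1 : MemLp (fun t => (v t).1) 2 (leb T) :=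
    h.of_le (continuous_subtype_val.comp_aestronglyMeasurable h.1)
      (Eventually.of_forall fun _ => le_rfl)
  exact (derivCLM L 2 k).integrable_comp (memLp_integrable h1)

/-- The time derivative is given only for `w` itself in `L²`. Since `w = prim (prim w_xx)`, and
likewise for `w_t`, injectivity of `prim ∘ prim` transfers it to `w_xx`. -/
theorem IsH4WeakSolution.exists_primitive_second (hL : 0 < L) (hT : 0 < T)
    (h : IsH4WeakSolution D L T p w0 w1 w wt wtt) :
    ∃ u, IsPrimitive T u (fun t => (wt t).1.d 2) ∧ ∀ᵐ t ∂leb T, (w t).d 2 = u t := by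
  have hf : Integrable (fun t => (w t).d 2) (leb T) :=
    (derivCLM L 4 2).integrable_comp (memLp_integrable h.memLp_w)
  have hg : Integrable (fun t => (wt t).1.d 2) (leb T) :=
    integrable_d_of_memLp h.memLp_wt 2
  refine HasWeakTimeDeriv.exists_isPrimitive hT hf hg ?_
  refine HasWeakTimeDeriv.of_injective ((prim L).comp (prim L))
    ((prim_injective hL).comp (prim_injective hL)) hf hg ?_
  refine h.weak.deriv_w.congr ?_ ?_
  · filter_upwards [h.weak.mem_H2star] with t ht using d_zero_of_mem_H2star hL ht
  · exact Eventually.of_forall fun t => d_zero_of_mem_H2star hL (wt t).2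

theorem IsH4WeakSolution.exists_primitive_first (hL : 0 < L) (hT : 0 < T)
    (h : IsH4WeakSolution D L T p w0 w1 w wt wtt) :
    ∃ v, IsPrimitive T v wtt ∧ ∀ᵐ t ∂leb T, (wt t).1.d 0 = v t := by
  have hf : Integrable (fun t => (wt t).1.d 0) (leb T) := integrable_d_of_memLp h.memLp_wt 0
  have hg : Integrable wtt (leb T) := memLp_integrable h.memLp_wtt
  exact HasWeakTimeDeriv.exists_isPrimitive hT hf hg
    (HasWeakTimeDeriv.of_toDual hL hf hg h.weak.deriv_wt)

end Solutions

/-! ### Identification of the initial data. -/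

section InitialValues

theorem neBot_nhdsGT_inf_ae : (𝓝[>] (0 : ℝ) ⊓ ae volume).NeBot := by
  refine inf_neBot_iff.2 fun s hs s' hs' => ?_
  obtain ⟨ε, hε, hεs⟩ := mem_nhdsGT_iff_exists_Ioo_subset.1 hs
  have h1 : volume (Ioo 0 ε ∩ s') ≠ 0 := by
    rw [measure_inter_conull hs', Real.volume_Ioo]
    simpa using hε
  obtain ⟨x, hx, hx'⟩ := nonempty_of_measure_ne_zero h1
  exact ⟨x, hεs hx, hx'⟩

/-- The filter is nontrivial, since right neighbourhoods of `0` have positive measure even after a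
null set is removed. Uniqueness of weak limits along it identifies the value at `0`. -/
theorem eq_of_tendsto_inner {H : Type*} [NormedAddCommGroup H] [InnerProductSpace ℝ H] {T : ℝ}
    (hT : 0 < T) {u f : ℝ → H} (hu : ContinuousOn u (Icc 0 T)) (hf : ∀ᵐ t ∂leb T, f t = u t)
    {a : H} (h : ∀ ψ, Tendsto (fun t => ⟪f t, ψ⟫_ℝ) (𝓝[>] 0 ⊓ ae volume) (𝓝 ⟪a, ψ⟫_ℝ)) :
    u 0 = a := by
  have := neBot_nhdsGT_inf_ae
  refine ext_inner_right ℝ fun ψ => ?_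
  refine tendsto_nhds_unique ?_ (h ψ)
  have h1 : Tendsto u (𝓝[>] 0 ⊓ ae volume) (𝓝 (u 0)) :=
    (hu 0 ⟨le_rfl, hT.le⟩).mono_left (inf_le_left.trans (nhdsWithin_le_iff.2
      (mem_of_superset (Ioo_mem_nhdsGT hT) Ioo_subset_Icc_self)))
  refine (h1.inner tendsto_const_nhds).congr' ?_
  have h2 : ∀ᶠ t in 𝓝[>] (0 : ℝ) ⊓ ae volume, t ∈ Ioo 0 T :=
    Eventually.filter_mono inf_le_left (Ioo_mem_nhdsGT hT)
  have h3 : ∀ᶠ t in 𝓝[>] (0 : ℝ) ⊓ ae volume, t ∈ Ioo 0 T → f t = u t :=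
    Eventually.filter_mono inf_le_right ((ae_restrict_iff' measurableSet_Ioo).1 hf)
  filter_upwards [h2, h3] with t h4 h5
  rw [h5 h4]

end InitialValues

/-! ### The representative in `C([0, T]; H³)` and the proof of part 2. -/

noncomputable section ContinuousRepresentative

variable {D L T : ℝ}

/-- The hypothesis says that `prim (prim ψ) ↦ ⟪u, ψ⟫` is a well-defined functional of norm at most
`C` on the range. Hahn–Banach and Riesz represent it by `k`, and adjointness gives `u`. -/
theorem exists_eq_primR_primR (hL : 0 < L) {C : ℝ} (hC : 0 ≤ C) {u : L2 L}
    (h : ∀ ψ, |⟪u, ψ⟫_ℝ| ≤ C * ‖prim L (prim L ψ)‖) :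
    ∃ k, ‖k‖ ≤ C ∧ u = primR L (primR L k) := by
  obtain ⟨K, hK⟩ : ∃ K : L2 L →ₗ[ℝ] L2 L, K = (prim L).toLinearMap ∘ₗ (prim L).toLinearMap :=
    ⟨_, rfl⟩
  have hKa : ∀ ψ, K ψ = prim L (prim L ψ) := fun ψ => by rw [hK]; rfl
  have hinj : Function.Injective K := by
    rw [hK]
    exact (prim_injective hL).comp (prim_injective hL)
  let e := LinearEquiv.ofInjective K hinj
  have he : ∀ y, prim L (prim L (e.symm y)) = y.1 := fun y => by
    rw [← hKa]
    exact congrArg Subtype.val (e.apply_symm_apply y)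
  let φ : LinearMap.range K →L[ℝ] ℝ :=
    LinearMap.mkContinuous ((innerSL ℝ u).toLinearMap ∘ₗ e.symm.toLinearMap) C fun y => by
      have := h (e.symm y)
      rw [he] at this
      exact this
  obtain ⟨g, hg1, hg2⟩ := exists_extension_norm_eq (LinearMap.range K) φ
  refine ⟨(InnerProductSpace.toDual ℝ (L2 L)).symm g, ?_, ?_⟩
  · rw [LinearIsometryEquiv.norm_map, hg2]
    exact LinearMap.mkContinuous_norm_le _ hC _
  · refine ext_inner_right ℝ fun ψ => ?_
    have h1 := hg1 (e ψ)
    have h2 : φ (e ψ) = ⟪u, e.symm (e ψ)⟫_ℝ := rfl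
    have h3 : ((e ψ : LinearMap.range K) : L2 L) = prim L (prim L ψ) := hKa ψ
    rw [h2, e.symm_apply_apply, h3] at h1
    rw [← h1, real_inner_comm, ← inner_prim_left hL.le, ← inner_prim_left hL.le, real_inner_comm,
      InnerProductSpace.toDual_symm_apply]

/-- The element of `H³(0, L)` with second derivative `primR (primR k)`, clamped at `0` and free at
`L`. -/
def ofFourthDeriv (hL : 0 ≤ L) (k : L2 L) : Sob L 3 :=
  ⟨WithLp.toLp 2 ![prim L (prim L (primR L (primR L k))), prim L (primR L (primR L k)),
      primR L (primR L k), primR L (-k)], by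
    intro i
    fin_cases i
    · exact hasWeakDeriv_prim hL _
    · exact hasWeakDeriv_prim hL _
    · have := hasWeakDeriv_primR hL (primR L (-k))
      rwa [← map_neg, neg_neg] at this⟩

/-- The function `k` is merely bounded. Interpolation between this bound and continuity of `primR
(primR k)` yields continuity of `primR k`, hence in `H³`. -/
theorem continuousOn_ofFourthDeriv (hL : 0 ≤ L) {C : ℝ} {k : ℝ → L2 L} {s : Set ℝ}
    (hk : ∀ t ∈ s, ‖k t‖ ≤ C) (hc : ContinuousOn (fun t => primR L (primR L (k t))) s) :
    ContinuousOn (fun t => ofFourthDeriv hL (k t)) s := by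
  have h4 : ContinuousOn (fun t => primR L (k t)) s := by
    intro a ha
    refine Metric.tendsto_nhds.2 fun δ hδ => ?_
    have hε : 0 < δ ^ 2 / (12 * C ^ 2 + 1) := by positivity
    -- The bounded part contributes `3 ε (2 C)² = 12 C² ε`; the added `1` makes this strictly less
    -- than `δ²` and covers `C = 0`.
    set ε := δ ^ 2 / (12 * C ^ 2 + 1) with hεd
    have hlim : Tendsto (fun t => 3 * (ε * (2 * C) ^ 2 + ε⁻¹ *
        ‖primR L (primR L (k t)) - primR L (primR L (k a))‖ ^ 2)) (𝓝[s] a)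
        (𝓝 (3 * (ε * (2 * C) ^ 2 + ε⁻¹ *
        ‖primR L (primR L (k a)) - primR L (primR L (k a))‖ ^ 2))) :=
      ((((((hc a ha).tendsto).sub tendsto_const_nhds).norm.pow 2).const_mul _).const_add
        _).const_mul _
    have hlt : 3 * (ε * (2 * C) ^ 2 + ε⁻¹ *
        ‖primR L (primR L (k a)) - primR L (primR L (k a))‖ ^ 2) < δ ^ 2 := by
      have h1 : ε * (12 * C ^ 2 + 1) = δ ^ 2 := by
        rw [hεd]
        field_simp
      rw [sub_self, norm_zero]
      linarith
    filter_upwards [hlim.eventually_lt_const hlt, self_mem_nhdsWithin] with t h1 h2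
    rw [dist_eq_norm, ← map_sub]
    refine lt_of_pow_lt_pow_left₀ 2 hδ.le (lt_of_le_of_lt ?_ h1)
    refine (norm_sq_primR_le hL (k t - k a) hε).trans ?_
    rw [map_sub, map_sub]
    have h3 : ‖k t - k a‖ ≤ 2 * C := by
      refine (norm_sub_le _ _).trans ?_
      linarith [hk t h2, hk a ha]
    gcongr
  refine Topology.IsInducing.subtypeVal.continuousOn_iff.2 ?_
  refine (PiLp.continuous_toLp 2 _).comp_continuousOn (continuousOn_pi.2 fun i => ?_)
  fin_cases i
  · exact (prim L).continuous.comp_continuousOn ((prim L).continuous.comp_continuousOn hc)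
  · exact (prim L).continuous.comp_continuousOn hc
  · exact hc
  · refine h4.neg.congr fun t _ => ?_
    exact map_neg _ _

variable {p : ℝ → L2 L} {w0 : H2star L} {w1 : L2 L}
  {w : ℝ → Sob L 4} {wt : ℝ → H2star L} {wtt : ℝ → L2 L}

theorem exists_bound_of_continuousOn_ae {E : Type*} [NormedAddCommGroup E] {u f : ℝ → E}
    (hu : ContinuousOn u (Icc 0 T)) (h : ∀ᵐ t ∂leb T, f t = u t) :
    ∃ C, ∀ᵐ t ∂leb T, ‖f t‖ ≤ C := by
  obtain ⟨C, hC⟩ := isCompact_Icc.exists_bound_of_continuousOn hu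
  refine ⟨C, ?_⟩
  filter_upwards [h, ae_mem_Icc] with t h1 h2
  rw [h1]
  exact hC t h2

/-- The abstract estimate bounds `w_tt`; the load and `w_xx` are bounded by continuity in time, so
`stationary_regularity` bounds `w_xxxx`. -/
theorem IsH4WeakSolution.exists_bound_fourth (hD : 0 < D) (hL : 0 < L) (hT : 0 < T)
    (h : IsH4WeakSolution D L T p w0 w1 w wt wtt) (hp : MemH2Time T p) {u v : ℝ → L2 L}
    (hu : IsPrimitive T u (fun t => (wt t).1.d 2)) (hwu : ∀ᵐ t ∂leb T, (w t).d 2 = u t)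
    (hv : IsPrimitive T v wtt) (hwv : ∀ᵐ t ∂leb T, (wt t).1.d 0 = v t) :
    ∃ C, ∀ᵐ t ∂leb T, ‖(w t).d 4‖ ≤ C := by
  obtain ⟨pt, ptt, m0, m1, m2, d1, d2⟩ := hp
  obtain ⟨r, M, hpr, hrc, hr⟩ := exists_lipschitz_of_second_derivative hT (memLp_integrable m0)
    (memLp_integrable m1) (memLp_integrable m2) d1 d2
  -- The symmetrised bilinear map has `S f f = 2 P(f, f)`, which accounts for the factor `D / 2` in
  -- the abstract equation.
  obtain ⟨S, hS⟩ : ∃ S : L2 L →L[ℝ] L2 L →L[ℝ] L2 L,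
      ∀ f g, S f g = mulPrim L f g + mulPrim L g f :=
    ⟨mulPrim L + (mulPrim L).flip, fun _ _ => rfl⟩
  obtain ⟨K, hK⟩ : ∃ K : L2 L →L[ℝ] L2 L, ∀ f, K f = prim L (prim L f) :=
    ⟨(prim L).comp (prim L), fun _ => rfl⟩
  have hSK : ∀ ε > 0, ∃ C, ∀ f, ‖S f f‖ ≤ ε * ‖f‖ ^ 2 + C * ‖K f‖ ^ 2 := fun ε hε => by
    obtain ⟨C, hC⟩ := norm_mulPrim_self_le hL.le (half_pos hε)
    refine ⟨2 * C, fun f => ?_⟩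
    rw [hS, hK]
    refine (norm_add_le _ _).trans ?_
    linarith [hC f]
  have hvK : ∀ᵐ t ∂leb T, v t = K ((wt t).1.d 2) := by
    filter_upwards [hwv] with t ht
    rw [← ht, hK]
    exact d_zero_of_mem_H2star hL (wt t).2
  have heq : ∀ᵐ t ∂leb T, ∀ ψ, ⟪wtt t, K ψ⟫_ℝ + D * ⟪u t, ψ⟫_ℝ
      + D / 2 * ⟪S (u t) (u t), S (u t) ψ⟫_ℝ = ⟪r t, K ψ⟫_ℝ := by
    filter_upwards [h.weak_equation hL, hwu, hpr] with t h1 h2 h3 ψ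
    have h4 := h1 ψ
    rw [h2, h3, inner_sub_left] at h4
    rw [hS, hS, hK, ← two_smul ℝ (mulPrim L (u t) (u t)), real_inner_smul_left]
    linarith
  obtain ⟨A, hA⟩ := exists_ae_bound_second_derivative hT hD S
    (fun f g => by rw [hS, hS, add_comm]) K hSK hu hv hvK hr heq
  obtain ⟨P, hP⟩ := exists_bound_of_continuousOn_ae hrc hpr
  obtain ⟨F, hF⟩ := exists_bound_of_continuousOn_ae hu.continuousOn hwu
  refine ⟨fourthDerivBound D L (A + P) F, ?_⟩
  filter_upwards [h.weak_equation hL, hA, hP, hF] with t h1 h2 h3 h4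
  exact (stationary_regularity hL hD ((w t).2 2) ((w t).2 3) h1).2.2 _ _
    ((norm_sub_le _ _).trans (add_le_add h2 h3)) h4

theorem d_three_of_mem_domA (hL : 0 < L) {v : Sob L 4} (hv : v ∈ domA L) :
    v.d 3 = primR L (-v.d 4) :=
  primR_eq_of_hasValueAt hL (v.2 3) hv.2.2.2

theorem d_two_of_mem_domA (hL : 0 < L) {v : Sob L 4} (hv : v ∈ domA L) :
    v.d 2 = primR L (primR L (v.d 4)) := by
  have h1 : v.d 2 = primR L (-v.d 3) := primR_eq_of_hasValueAt hL (v.2 2) hv.2.2.1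
  rw [h1, d_three_of_mem_domA hL hv, ← map_neg, neg_neg]

theorem ofFourthDeriv_d_four (hL : 0 < L) {v : Sob L 4} (hv : v ∈ domA L) :
    ofFourthDeriv hL.le (v.d 4) = v.incl 3 (by lia) := by
  have h2 := d_two_of_mem_domA hL hv
  have h1 : v.d 1 = prim L (v.d 2) := prim_eq_of_hasValueAt hL (v.2 1) hv.2.1
  have h0 : v.d 0 = prim L (v.d 1) := prim_eq_of_hasValueAt hL (v.2 0) hv.1
  refine Subtype.ext (PiLp.ext fun i => ?_)
  fin_cases i
  · change prim L (prim L (primR L (primR L (v.d 4)))) = v.d 0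
    rw [h0, h1, h2]
  · change prim L (primR L (primR L (v.d 4))) = v.d 1
    rw [h1, h2]
  · exact h2.symm
  · exact (d_three_of_mem_domA hL hv).symm

theorem IsStrongSolution.satisfiesBoundaryAndInitialConditions (hD : 0 < D) (hL : 0 < L)
    (hT : 0 < T) (h : IsStrongSolution D L T p w0 w1 w wt wtt) (hp : MemH2Time T p) :
    SatisfiesBoundaryAndInitialConditions L T w0 w1 w wt := by
  obtain ⟨u, hu, hwu⟩ := h.toIsH4WeakSolution.exists_primitive_second hL hT
  obtain ⟨v, hv, hwv⟩ := h.toIsH4WeakSolution.exists_primitive_first hL hT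
  obtain ⟨C', hC'⟩ := h.toIsH4WeakSolution.exists_bound_fourth hD hL hT hp hu hwu hv hwv
  obtain ⟨C, hC0, hC⟩ : ∃ C, 0 ≤ C ∧ ∀ᵐ t ∂leb T, ‖(w t).d 4‖ ≤ C :=
    ⟨max C' 0, le_max_right _ _, hC'.mono fun t ht => ht.trans (le_max_left _ _)⟩
  have hbound : ∀ t ∈ Icc 0 T, ∀ ψ, |⟪u t, ψ⟫_ℝ| ≤ C * ‖prim L (prim L ψ)‖ := by
    intro t ht ψ
    have hc : ContinuousOn (fun t => |⟪u t, ψ⟫_ℝ|) (Icc 0 T) :=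
      (hu.continuousOn.inner continuousOn_const).abs
    -- The inequality is written as an equality of two continuous functions of `t`, so that it
    -- passes from almost every time to every time.
    have h1 : (fun t => min |⟪u t, ψ⟫_ℝ| (C * ‖prim L (prim L ψ)‖))
        =ᵐ[leb T] fun t => |⟪u t, ψ⟫_ℝ| := by
      filter_upwards [hwu, hC, h.mem_domA] with s h1 h2 h3
      refine min_eq_left ?_
      rw [← h1, d_two_of_mem_domA hL h3, real_inner_comm, ← inner_prim_left hL.le,
        ← inner_prim_left hL.le, real_inner_comm]
      exact (abs_real_inner_le_norm _ _).trans (by gcongr)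
    exact min_eq_left_iff.1 (eqOn_Icc_of_ae_eq hT (hc.inf continuousOn_const) hc h1 ht)
  have hex : ∀ t ∈ Icc 0 T, ∃ k, ‖k‖ ≤ C ∧ u t = primR L (primR L k) := fun t ht =>
    exists_eq_primR_primR hL hC0 (hbound t ht)
  choose! k hk1 hk2 using hex
  have hu0 : u 0 = w0.1.d 2 := by
    refine eq_of_tendsto_inner hT hu.continuousOn hwu fun ψ => ?_
    have h1 := (h.weak.initial_w (ofSecondDeriv hL.le ψ)).const_mul D⁻¹
    have h2 : ∀ f : L2 L, D⁻¹ * (D * ∫ x in Ioo 0 L, f x * ψ x) = ⟪f, ψ⟫_ℝ := fun f => by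
      rw [inner_eq_integral, inv_mul_cancel_left₀ hD.ne']
    rw [← h2]
    exact h1.congr fun t => h2 _
  have hv0 : v 0 = w1 := by
    refine eq_of_tendsto_inner hT hv.continuousOn hwv fun ψ => ?_
    simp only [inner_eq_integral]
    exact h.weak.initial_wt ψ
  refine ⟨fun t => ofFourthDeriv hL.le (k t), v,
    continuousOn_ofFourthDeriv hL.le hk1 (hu.continuousOn.congr fun t ht => (hk2 t ht).symm),
    hv.continuousOn, ?_, hwv.mono fun t ht => ht.symm, ?_, hv0, fun t _ => ⟨hasValueAt_prim _,
      hasValueAt_prim _, hasValueAt_primR hL.le _, hasValueAt_primR hL.le _⟩⟩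
  · filter_upwards [hwu, h.mem_domA, ae_mem_Icc] with t h1 h2 h3
    rw [← ofFourthDeriv_d_four hL h2]
    congr 1
    refine primR_injective hL (primR_injective hL ?_)
    rw [← hk2 t h3, ← h1, d_two_of_mem_domA hL h2]
  · have h2 : primR L (primR L (k 0)) = w0.1.d 2 := by rw [← hk2 0 ⟨le_rfl, hT.le⟩, hu0]
    refine Subtype.ext (PiLp.ext fun i => ?_)
    fin_cases i
    · change prim L (prim L (primR L (primR L (k 0)))) = w0.1.d 0
      rw [h2, d_zero_of_mem_H2star hL w0.2]
    · change prim L (primR L (primR L (k 0))) = w0.1.d 1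
      rw [h2, d_one_of_mem_H2star hL w0.2]
    · exact h2

end ContinuousRepresentative

end Cantilever

theorem corollary4p2 {D L T : ℝ} (hD : 0 < D) (hL : 0 < L) (hT : 0 < T)
    (p : ℝ → Cantilever.L2 L) (hp : MemLp p 2 (Cantilever.leb T))
    (w0 : Cantilever.H2star L) (w1 : Cantilever.L2 L)
    (w : ℝ → Cantilever.Sob L 4) (wt : ℝ → Cantilever.H2star L) (wtt : ℝ → Cantilever.L2 L) :
    (Cantilever.IsStrongSolution D L T p w0 w1 w wt wtt →
      Cantilever.SatisfiesPDE D L T p w wtt ∧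
      (Cantilever.MemH2Time T p →
        Cantilever.SatisfiesBoundaryAndInitialConditions L T w0 w1 w wt)) ∧
    (Cantilever.IsH4WeakSolution D L T p w0 w1 w wt wtt →
      Cantilever.IsStrongSolution D L T p w0 w1 w wt wtt) :=
  ⟨fun h => ⟨h.toIsH4WeakSolution.satisfiesPDE hL hD,
    h.satisfiesBoundaryAndInitialConditions hD hL hT⟩, fun h => h.isStrongSolution hL hD⟩
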